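/- Let $\mathcal A:\mathbb R^{n_1\times n_2}\to\mathbb R^m$ be a linear map, $n=\max(n_1,n_2)$, and let $\mathcal A^*$ be its adjoint for the inner products $\langle X,Y\rangle=\operatorname{trace}(X^{\mathsf T}Y)$ and the Euclidean one. Write $\|X\|$, $\|X\|_F$, $\|X\|_*$ for the operator, Frobenius and nuclear norms and $\sigma_i(X)$ for the singular values of $X$. For $k\ge 1$ let $\delta_k\ge 0$ be the smallest number with $$(1-\delta_k)\|X\|_F^2\le\|\mathcal A(X)\|_{\ell_2}^2\le(1+\delta_k)\|X\|_F^2\quad\text{for all } X \text{ of rank at most } k.$$ Let $M\in\mathbb R^{n_1\times n_2}$ with $\operatorname{rank}(M)\le r$, where $r\ge 1$, and observe $y=\mathcal A(M)+z$, where $z\in\mathbb R^m$ has i.i.d. $\mathcal N(0,\sigma^2)$ entries, $\sigma>0$. The matrix Dantzig selector $\hat M_{DS}$ is any minimizer of $\|X\|_*$ subject to $\|\mathcal A^*(y-\mathcal A(X))\|\le\lambda$, with $\lambda=16\sqrt n\,\sigma$; the matrix Lasso $\hat M_L$ is any minimizer of $\tfrac12\|\mathcal A(X)-y\|_{\ell_2}^2+\mu\|X\|_*$,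 with $\mu=32\sqrt n\,\sigma$. **Theorem.** There are a numerical constant $c>0$ and constants $C_0=C_0(\delta_{4r})$, $C_1=C_1(\delta_{4r})$ depending only on $\delta_{4r}$ such that, with probability at least $1-2e^{-cn}$, the following both hold. 1. If $\delta_{4r}<\sqrt2-1$, then every matrix Dantzig selector solution satisfies $$\|\hat M_{DS}-M\|_F^2\le C_0\sum_i\min(\sigma_i^2(M),\,n\sigma^2).$$ 2. If $\delta_{4r}<(3\sqrt2-1)/17$, then every matrix Lasso solution satisfies $$\|\hat M_L-M\|_F^2\le C_1\sum_i\min(\sigma_i^2(M),\,n\sigma^2).$$ -/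

import Mathlib

open MeasureTheory ProbabilityTheory

noncomputable section

namespace MatrixRecovery

/-- The Frobenius norm of a real matrix. -/
def frobNorm {n₁ n₂ : ℕ} (X : Matrix (Fin n₁) (Fin n₂) ℝ) : ℝ :=
  Matrix.frobeniusNormedAddCommGroup.toNorm.norm X

/-- The operator (spectral) norm of a real matrix, with respect to Euclidean norms. -/
def opNorm {n₁ n₂ : ℕ} (X : Matrix (Fin n₁) (Fin n₂) ℝ) : ℝ :=
  Matrix.instL2OpNormedAddCommGroup.toNorm.norm X

/-- The singular values of a real matrix in decreasing order, indexed from `0`; there are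
`min n₁ n₂` of them and the entries of the sequence beyond that index vanish. -/
def singVal {n₁ n₂ : ℕ} (X : Matrix (Fin n₁) (Fin n₂) ℝ) (i : ℕ) : ℝ :=
  (Matrix.toEuclideanLin X).singularValues i

/-- The nuclear norm: the sum of the singular values. -/
def nuclearNorm {n₁ n₂ : ℕ} (X : Matrix (Fin n₁) (Fin n₂) ℝ) : ℝ :=
  ∑ i ∈ Finset.range (min n₁ n₂), singVal X i

/-- The adjoint of a linear measurement map `A`: writing `[A X]_i = ⟨A_i, X⟩`, the `(k, l)` entry of
`∑ i, q_i A_i` is `∑ i, q_i [A E_{kl}]_i`, where `E_{kl}` is the elementary matrix. -/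
def adjointMap {n₁ n₂ m : ℕ}
    (A : Matrix (Fin n₁) (Fin n₂) ℝ →ₗ[ℝ] EuclideanSpace ℝ (Fin m))
    (q : EuclideanSpace ℝ (Fin m)) : Matrix (Fin n₁) (Fin n₂) ℝ :=
  Matrix.of fun k l => ∑ i, q i * A (Matrix.single k l 1) i

/-- The defining property of the adjoint for the inner product `⟨X, Y⟩ = trace (Xᵀ Y)`. -/
theorem inner_map_eq_trace_adjointMap {n₁ n₂ m : ℕ}
    (A : Matrix (Fin n₁) (Fin n₂) ℝ →ₗ[ℝ] EuclideanSpace ℝ (Fin m))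
    (X : Matrix (Fin n₁) (Fin n₂) ℝ) (q : EuclideanSpace ℝ (Fin m)) :
    inner ℝ (A X) q = (X.transpose * adjointMap A q).trace := by
  have hX : A X = ∑ k, ∑ l, X k l • A (Matrix.single k l 1) := by
    conv_lhs => rw [Matrix.matrix_eq_sum_single X]
    simp only [map_sum]
    refine Finset.sum_congr rfl fun k _ => Finset.sum_congr rfl fun l _ => ?_
    rw [← map_smul, Matrix.smul_single, smul_eq_mul, mul_one]
  rw [hX]
  simp only [sum_inner, Matrix.trace, Matrix.diag, Matrix.mul_apply, Matrix.transpose_apply,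
    adjointMap, Matrix.of_apply, PiLp.inner_apply, Finset.mul_sum]
  rw [Finset.sum_comm]
  simp [mul_left_comm]

/-- The bounds `δ ≥ 0` for which `A` is a `δ`-near isometry on matrices of rank at most `k`. -/
def isometryBounds {n₁ n₂ m : ℕ}
    (A : Matrix (Fin n₁) (Fin n₂) ℝ →ₗ[ℝ] EuclideanSpace ℝ (Fin m)) (k : ℕ) : Set ℝ :=
  {δ | 0 ≤ δ ∧ ∀ X : Matrix (Fin n₁) (Fin n₂) ℝ, X.rank ≤ k →
    (1 - δ) * frobNorm X ^ 2 ≤ ‖A X‖ ^ 2 ∧ ‖A X‖ ^ 2 ≤ (1 + δ) * frobNorm X ^ 2}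

/-- The isometry constant `δ_k` of `A`: the smallest element of `isometryBounds A k`. -/
def isometryConst {n₁ n₂ m : ℕ}
    (A : Matrix (Fin n₁) (Fin n₂) ℝ →ₗ[ℝ] EuclideanSpace ℝ (Fin m)) (k : ℕ) : ℝ :=
  sInf (isometryBounds A k)

open scoped Matrix.Norms.Frobenius in
/-- The smallest isometry bound exists. -/
theorem isLeast_isometryConst {n₁ n₂ m : ℕ}
    (A : Matrix (Fin n₁) (Fin n₂) ℝ →ₗ[ℝ] EuclideanSpace ℝ (Fin m)) (k : ℕ) :
    IsLeast (isometryBounds A k) (isometryConst A k) := by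
  have hbdd : BddBelow (isometryBounds A k) := ⟨0, fun δ h => h.1⟩
  have hne : (isometryBounds A k).Nonempty := by
    obtain ⟨K, -, hK⟩ := SemilinearMapClass.bound_of_continuous A
      A.continuous_of_finiteDimensional
    refine ⟨1 + K ^ 2, by positivity, fun X _ => ?_⟩
    have h1 : ‖A X‖ ^ 2 ≤ (K * ‖X‖) ^ 2 := pow_le_pow_left₀ (norm_nonneg _) (hK X) 2
    have h2 : frobNorm X = ‖X‖ := rfl
    rw [h2]
    constructor
    · nlinarith [sq_nonneg ‖A X‖, mul_nonneg (sq_nonneg K) (sq_nonneg ‖X‖)]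
    · nlinarith [sq_nonneg ‖X‖]
  have hcl : IsClosed (isometryBounds A k) := by
    simp only [isometryBounds, Set.ofPred_and, Set.ofPred_forall]
    refine (isClosed_le (by fun_prop) (by fun_prop)).inter ?_
    refine isClosed_iInter fun X => isClosed_iInter fun _ => ?_
    exact (isClosed_le (by fun_prop) (by fun_prop)).inter
      (isClosed_le (by fun_prop) (by fun_prop))
  exact ⟨hcl.csInf_mem hne hbdd, fun δ h => csInf_le hbdd h⟩

/-- `X` is a solution of the matrix Dantzig selector: minimise the nuclear norm subject to
`‖A^*(y - A X)‖ ≤ lam`, the norm in the constraint being the operator norm. -/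
def IsDantzigSolution {n₁ n₂ m : ℕ}
    (A : Matrix (Fin n₁) (Fin n₂) ℝ →ₗ[ℝ] EuclideanSpace ℝ (Fin m))
    (y : EuclideanSpace ℝ (Fin m)) (lam : ℝ) (X : Matrix (Fin n₁) (Fin n₂) ℝ) : Prop :=
  opNorm (adjointMap A (y - A X)) ≤ lam ∧
    ∀ X' : Matrix (Fin n₁) (Fin n₂) ℝ,
      opNorm (adjointMap A (y - A X')) ≤ lam → nuclearNorm X ≤ nuclearNorm X'

/-- `X` is a solution of the matrix Lasso: minimise `‖A X - y‖² / 2 + μ ‖X‖_*`. -/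
def IsLassoSolution {n₁ n₂ m : ℕ}
    (A : Matrix (Fin n₁) (Fin n₂) ℝ →ₗ[ℝ] EuclideanSpace ℝ (Fin m))
    (y : EuclideanSpace ℝ (Fin m)) (μ : ℝ) (X : Matrix (Fin n₁) (Fin n₂) ℝ) : Prop :=
  ∀ X' : Matrix (Fin n₁) (Fin n₂) ℝ,
    1 / 2 * ‖A X - y‖ ^ 2 + μ * nuclearNorm X ≤ 1 / 2 * ‖A X' - y‖ ^ 2 + μ * nuclearNorm X'

/-- `z` is a Gaussian noise vector: its coordinates are independent with law `N(0, σ²)`. -/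
def IsGaussianNoise {Ω : Type*} [MeasurableSpace Ω] {m : ℕ} (P : Measure Ω) (σ : ℝ)
    (z : Ω → EuclideanSpace ℝ (Fin m)) : Prop :=
  (∀ i, HasLaw (fun ω => z ω i) (gaussianReal 0 (Real.toNNReal (σ ^ 2))) P) ∧
    iIndepFun (fun i ω => z ω i) P

/-- The ideal bias-variance trade-off `∑ i, min (σ_i(M)², n σ²)` with `n = max n₁ n₂`. -/
def oracleRisk {n₁ n₂ : ℕ} (M : Matrix (Fin n₁) (Fin n₂) ℝ) (σ : ℝ) : ℝ :=
  ∑ i ∈ Finset.range (min n₁ n₂), min (singVal M i ^ 2) ((max n₁ n₂ : ℕ) * σ ^ 2)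

end MatrixRecovery

end

/-! Everything is deterministic once the back-projected noise satisfies `‖A^* z‖ ≤ l`, with `l = 8
√n σ`. This event comes from 1/4-nets of the two unit balls: the bilinear form of `A^* z` at a pair
`(u, v)` is Gaussian with variance `σ² ‖A(u vᵀ)‖²`, which the isometry constant controls, and there
are at most `81 ^ n` pairs (`exists_event_opNorm_adjointMap_le`).

Comparing an estimator with `M` itself would give an error proportional to `rank M`. Instead it is
compared with a proxy `B` that nearly minimizes `K(X) = (l/2)² rank X + ‖A X - A M‖²`
(`exists_proxy`). Thresholding the singular values of `M` shows that `K(B)` is at most a multiple of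
the oracle risk. Near-minimality also gives `‖A^*(A M - A B)‖ ≤ l`, for otherwise a rank-one
correction would pay for the extra rank. Hence `‖A^*(y - A B)‖ ≤ 2l`: `B` is feasible for the
Dantzig selector (`λ = 2l`), and its residual is half as large as the Lasso penalty (`μ = 4l`).

Optimality then places `X - B` in a cone where the nuclear norm of the part orthogonal to `B` is at
most `κ` times that of a part of rank at most `2 rank B`, with `κ = 1` for Dantzig and `κ = 3` for
Lasso. On such a cone restricted isometry gives `‖X - B‖_F ≤ C √(rank B) l` as soon as `(1 + √2 κ) δ
< 1` (`frobNorm_le_of_cone`); for `κ = 1, 3` these are exactly the two thresholds. Finally `rank B *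
l² ≤ 4 K(B)` and `(1 - δ) ‖B - M‖_F² ≤ K(B)`, so both pieces of `X - M` are bounded by the oracle
risk. -/

namespace MatrixRecovery

open Matrix

/-! ### Frobenius inner product and norm, and matrices of the form `U * diagonal f * Vᵀ` -/

variable {n₁ n₂ m : ℕ}

/-- The inner product `⟨X, Y⟩ = trace (Xᵀ Y)`. -/
noncomputable def frobInner (X Y : Matrix (Fin n₁) (Fin n₂) ℝ) : ℝ := (Xᵀ * Y).trace

theorem frobInner_eq_sum (X Y : Matrix (Fin n₁) (Fin n₂) ℝ) :
    frobInner X Y = ∑ i, ∑ j, X i j * Y i j := by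
  simp only [frobInner, trace, diag, mul_apply, transpose_apply]
  rw [Finset.sum_comm]

theorem frobInner_comm (X Y : Matrix (Fin n₁) (Fin n₂) ℝ) : frobInner X Y = frobInner Y X := by
  simp [frobInner_eq_sum, mul_comm]

theorem frobInner_add_left (X Y Z : Matrix (Fin n₁) (Fin n₂) ℝ) :
    frobInner (X + Y) Z = frobInner X Z + frobInner Y Z := by
  simp [frobInner, Matrix.add_mul]

theorem frobInner_add_right (X Y Z : Matrix (Fin n₁) (Fin n₂) ℝ) :
    frobInner X (Y + Z) = frobInner X Y + frobInner X Z := by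
  simp [frobInner, Matrix.mul_add]

theorem frobInner_smul_right (a : ℝ) (X Y : Matrix (Fin n₁) (Fin n₂) ℝ) :
    frobInner X (a • Y) = a * frobInner X Y := by
  simp [frobInner]

theorem frobInner_smul_left (a : ℝ) (X Y : Matrix (Fin n₁) (Fin n₂) ℝ) :
    frobInner (a • X) Y = a * frobInner X Y := by
  simp [frobInner]

theorem frobInner_neg_right (X Y : Matrix (Fin n₁) (Fin n₂) ℝ) :
    frobInner X (-Y) = -frobInner X Y := by
  simp [frobInner]

theorem frobInner_vecMulVec (u : Fin n₁ → ℝ) (v : Fin n₂ → ℝ) (Y : Matrix (Fin n₁) (Fin n₂) ℝ) :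
    frobInner (vecMulVec u v) Y = u ⬝ᵥ (Y *ᵥ v) := by
  simp only [frobInner_eq_sum, vecMulVec_apply, dotProduct, mulVec, Finset.mul_sum]
  exact Finset.sum_congr rfl fun i _ => Finset.sum_congr rfl fun j _ => by ring

open scoped Matrix.Norms.Frobenius in
theorem sq_frobNorm (X : Matrix (Fin n₁) (Fin n₂) ℝ) : frobNorm X ^ 2 = frobInner X X := by
  have h : frobNorm X = ‖X‖ := rfl
  rw [h, frobenius_norm_def, ← Real.sqrt_eq_rpow, Real.sq_sqrt (by positivity), frobInner_eq_sum]
  simp [sq]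

open scoped Matrix.Norms.Frobenius in
theorem frobNorm_nonneg (X : Matrix (Fin n₁) (Fin n₂) ℝ) : 0 ≤ frobNorm X := norm_nonneg X

open scoped Matrix.Norms.Frobenius in
theorem frobNorm_add_le (X Y : Matrix (Fin n₁) (Fin n₂) ℝ) :
    frobNorm (X + Y) ≤ frobNorm X + frobNorm Y := norm_add_le X Y

open scoped Matrix.Norms.Frobenius in
theorem frobNorm_sum_le {ι : Type*} (s : Finset ι) (X : ι → Matrix (Fin n₁) (Fin n₂) ℝ) :
    frobNorm (∑ i ∈ s, X i) ≤ ∑ i ∈ s, frobNorm (X i) := norm_sum_le s X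

open scoped Matrix.Norms.Frobenius in
theorem eq_zero_of_frobNorm_eq_zero {X : Matrix (Fin n₁) (Fin n₂) ℝ} (h : frobNorm X = 0) :
    X = 0 := norm_eq_zero.mp h

theorem sq_frobNorm_vecMulVec (u : Fin n₁ → ℝ) (v : Fin n₂ → ℝ) :
    frobNorm (vecMulVec u v) ^ 2 = (u ⬝ᵥ u) * (v ⬝ᵥ v) := by
  rw [sq_frobNorm, frobInner_eq_sum, dotProduct, dotProduct, Finset.sum_mul_sum]
  exact Finset.sum_congr rfl fun i _ => Finset.sum_congr rfl fun j _ => by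
    simp only [vecMulVec_apply]; ring

theorem sq_frobNorm_add (X Y : Matrix (Fin n₁) (Fin n₂) ℝ) :
    frobNorm (X + Y) ^ 2 = frobNorm X ^ 2 + 2 * frobInner X Y + frobNorm Y ^ 2 := by
  simp only [sq_frobNorm, frobInner_add_left, frobInner_add_right, frobInner_comm Y X]
  ring

theorem frobInner_mul_diagonal_mul {k : ℕ} (U : Matrix (Fin n₁) (Fin k) ℝ)
    (V : Matrix (Fin n₂) (Fin k) ℝ) (f : Fin k → ℝ) (Y : Matrix (Fin n₁) (Fin n₂) ℝ) :
    frobInner (U * diagonal f * Vᵀ) Y = ∑ i, f i * (Uᵀ * Y * V) i i := by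
  have h : frobInner (U * diagonal f * Vᵀ) Y = (diagonal f * (Uᵀ * Y * V)).trace := by
    rw [frobInner, transpose_mul, transpose_mul, transpose_transpose, diagonal_transpose,
      Matrix.mul_assoc V, trace_mul_comm V]
    simp only [Matrix.mul_assoc]
  rw [h]
  simp [trace, diagonal_mul]

theorem frobInner_mul_diagonal_mul_mul_diagonal_mul {k : ℕ} {U : Matrix (Fin n₁) (Fin k) ℝ}
    {V : Matrix (Fin n₂) (Fin k) ℝ} (hU : Uᵀ * U = 1) (hV : Vᵀ * V = 1) (f g : Fin k → ℝ) :
    frobInner (U * diagonal f * Vᵀ) (U * diagonal g * Vᵀ) = ∑ i, f i * g i := by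
  rw [frobInner_mul_diagonal_mul]
  have h : Uᵀ * (U * diagonal g * Vᵀ) * V = diagonal g := by
    calc _ = (Uᵀ * U) * diagonal g * (Vᵀ * V) := by simp only [Matrix.mul_assoc]
      _ = diagonal g := by rw [hU, hV, Matrix.one_mul, Matrix.mul_one]
  simp [h]

theorem rank_mul_diagonal_mul_le {k : ℕ} (U : Matrix (Fin n₁) (Fin k) ℝ)
    (V : Matrix (Fin n₂) (Fin k) ℝ) (f : Fin k → ℝ) :
    (U * diagonal f * Vᵀ).rank ≤ (Finset.univ.filter fun i => f i ≠ 0).card := by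
  refine (rank_mul_le_left _ _).trans ((rank_mul_le_right _ _).trans ?_)
  rw [rank_diagonal, Fintype.card_subtype]

/-! ### Singular values -/

theorem singVal_nonneg (X : Matrix (Fin n₁) (Fin n₂) ℝ) (i : ℕ) : 0 ≤ singVal X i :=
  LinearMap.singularValues_nonneg _ i

theorem singVal_antitone (X : Matrix (Fin n₁) (Fin n₂) ℝ) : Antitone (singVal X) :=
  LinearMap.singularValues_antitone _

theorem finrank_range_toEuclideanLin (X : Matrix (Fin n₁) (Fin n₂) ℝ) :
    Module.finrank ℝ (LinearMap.range (toEuclideanLin X)) = X.rank := by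
  rw [toEuclideanLin_eq_toLin_orthonormal]
  exact (rank_eq_finrank_range_toLin X _ _).symm

theorem singVal_pos_iff (X : Matrix (Fin n₁) (Fin n₂) ℝ) (i : ℕ) :
    0 < singVal X i ↔ i < X.rank := by
  rw [← finrank_range_toEuclideanLin]
  exact LinearMap.singularValues_pos_iff_lt_finrank_range _

theorem singVal_eq_zero_of_rank_le {X : Matrix (Fin n₁) (Fin n₂) ℝ} {i : ℕ} (h : X.rank ≤ i) :
    singVal X i = 0 :=
  le_antisymm (not_lt.mp fun h' => absurd ((singVal_pos_iff X i).mp h') (by omega))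
    (singVal_nonneg X i)

theorem rank_le_min (X : Matrix (Fin n₁) (Fin n₂) ℝ) : X.rank ≤ min n₁ n₂ :=
  le_min X.rank_le_height X.rank_le_width

theorem sum_range_singVal {X : Matrix (Fin n₁) (Fin n₂) ℝ} {N : ℕ} (h : X.rank ≤ N) :
    ∑ i ∈ Finset.range N, singVal X i = ∑ i : Fin X.rank, singVal X i := by
  rw [← Finset.sum_range (fun i => singVal X i)]
  refine (Finset.sum_subset (Finset.range_mono h) fun i _ hi => ?_).symm
  exact singVal_eq_zero_of_rank_le (by simpa using hi)

theorem nuclearNorm_eq_sum (X : Matrix (Fin n₁) (Fin n₂) ℝ) :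
    nuclearNorm X = ∑ i : Fin X.rank, singVal X i := sum_range_singVal (rank_le_min X)

/-- The compact singular value decomposition. -/
theorem exists_svd (X : Matrix (Fin n₁) (Fin n₂) ℝ) :
    ∃ (U : Matrix (Fin n₁) (Fin X.rank) ℝ) (V : Matrix (Fin n₂) (Fin X.rank) ℝ),
      Uᵀ * U = 1 ∧ Vᵀ * V = 1 ∧ X = U * diagonal (fun i : Fin X.rank => singVal X i) * Vᵀ := by
  set T := toEuclideanLin X with hT
  have hn : Module.finrank ℝ (EuclideanSpace ℝ (Fin n₂)) = n₂ := by simp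
  -- The right singular vectors are eigenvectors of `T^* T`, and the left ones are `T b_i / σ_i`.
  -- Only the first `X.rank` indices are kept, so every division is by a positive number.
  set b := T.isSymmetric_adjoint_comp_self.eigenvectorBasis hn with hb
  have hle : X.rank ≤ n₂ := X.rank_le_width
  have hin : ∀ i j, inner ℝ (T (b i)) (T (b j)) = if i = j then singVal X i ^ 2 else 0 := by
    intro i j
    have h1 := T.isSymmetric_adjoint_comp_self.apply_eigenvectorBasis hn i
    rw [← LinearMap.sq_singularValues_fin] at h1
    rw [← LinearMap.adjoint_inner_left, ← LinearMap.comp_apply, h1, real_inner_smul_left]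
    have h2 := orthonormal_iff_ite.mp b.orthonormal i j
    rw [← hb, h2]
    simp only [singVal, ← hT, mul_ite, mul_one, mul_zero]
    rfl
  have hT0 : ∀ j : Fin n₂, X.rank ≤ j → T (b j) = 0 := by
    intro j hj
    have := hin j j
    rw [if_pos rfl, singVal_eq_zero_of_rank_le hj] at this
    simpa using this
  have hpos : ∀ i : Fin X.rank, 0 < singVal X i := fun i => (singVal_pos_iff X i).mpr i.2
  refine ⟨of fun p i => (singVal X i)⁻¹ * T (b (i.castLE hle)) p,
    of fun q i => b (i.castLE hle) q, ?_, ?_, ?_⟩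
  · ext i j
    have h1 := hin (i.castLE hle) (j.castLE hle)
    rw [PiLp.inner_apply] at h1
    simp only [RCLike.inner_apply, conj_trivial] at h1
    have h2 : (∑ p, (singVal X i)⁻¹ * T (b (i.castLE hle)) p *
        ((singVal X j)⁻¹ * T (b (j.castLE hle)) p)) = (singVal X i)⁻¹ * (singVal X j)⁻¹ *
        ∑ p, T (b (j.castLE hle)) p * T (b (i.castLE hle)) p := by
      rw [Finset.mul_sum]
      exact Finset.sum_congr rfl fun p _ => by ring
    simp only [mul_apply, transpose_apply, of_apply]
    rw [h2, h1, one_apply]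
    by_cases hij : i = j
    · subst hij
      have := hpos i
      simp only [if_true, Fin.val_castLE]
      field_simp
    · rw [if_neg (fun h => hij (by simpa using h)), if_neg hij, mul_zero]
  · ext i j
    have h2 := orthonormal_iff_ite.mp b.orthonormal (i.castLE hle) (j.castLE hle)
    rw [PiLp.inner_apply] at h2
    simp only [RCLike.inner_apply, conj_trivial] at h2
    simp only [mul_apply, transpose_apply, of_apply, one_apply]
    calc _ = _ := Finset.sum_congr rfl fun p _ => mul_comm _ _
      _ = _ := h2
      _ = _ := by simp
  · ext p q
    have h1 : T (EuclideanSpace.single q 1) =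
        ∑ j, inner ℝ (b j) (EuclideanSpace.single q (1 : ℝ)) • T (b j) := by
      conv_lhs => rw [← b.sum_repr' (EuclideanSpace.single q (1 : ℝ))]
      simp
    have h2 := congrArg (fun w : EuclideanSpace ℝ (Fin n₁) => w p) h1
    have h3 : (T (EuclideanSpace.single q 1)) p = X p q := by
      simp [hT, toEuclideanLin, toLpLin_apply, col]
    simp only [h3] at h2
    rw [h2]
    have h4 : ∀ i : Fin X.rank, (singVal X i)⁻¹ * T (b (i.castLE hle)) p * singVal X i *
        b (i.castLE hle) q = b (i.castLE hle) q * T (b (i.castLE hle)) p := by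
      intro i
      have := (hpos i).ne'
      field_simp
    rw [mul_apply]
    simp only [mul_diagonal, transpose_apply, of_apply, h4]
    have h5 : (∑ j, inner ℝ (b j) (EuclideanSpace.single q (1 : ℝ)) • T (b j)) p
        = ∑ j, b j q * T (b j) p := by
      simp [EuclideanSpace.inner_single_right]
    rw [h5]
    refine (Finset.sum_of_injOn (Fin.castLE hle) (Fin.castLE_injective hle).injOn
      (by simp) ?_ fun i _ => rfl).symm
    intro j _ hj
    have : X.rank ≤ j := by
      by_contra h
      exact hj ⟨⟨j, by omega⟩, by simp, by ext; simp⟩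
    simp [hT0 j this]

/-! ### Operator norm and duality with the nuclear norm -/

theorem dotProduct_self_ofLp {n : ℕ} (u : EuclideanSpace ℝ (Fin n)) :
    u.ofLp ⬝ᵥ u.ofLp = ‖u‖ ^ 2 := by
  rw [EuclideanSpace.norm_sq_eq, dotProduct]
  simp [sq]

theorem dotProduct_eq_inner {n : ℕ} (u v : EuclideanSpace ℝ (Fin n)) :
    u.ofLp ⬝ᵥ v.ofLp = inner ℝ u v := by
  rw [PiLp.inner_apply, dotProduct]
  simp [mul_comm]

theorem dotProduct_mulVec_le (Y : Matrix (Fin n₁) (Fin n₂) ℝ) (u : EuclideanSpace ℝ (Fin n₁))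
    (v : EuclideanSpace ℝ (Fin n₂)) :
    u.ofLp ⬝ᵥ (Y *ᵥ v.ofLp) ≤ ‖u‖ * (opNorm Y * ‖v‖) := by
  have h : u.ofLp ⬝ᵥ (Y *ᵥ v.ofLp) = inner ℝ u (toEuclideanLin Y v) := by
    rw [← dotProduct_eq_inner]; rfl
  rw [h]
  exact (real_inner_le_norm _ _).trans
    (mul_le_mul_of_nonneg_left (l2_opNorm_mulVec Y v) (norm_nonneg u))

open scoped Matrix.Norms.L2Operator in
theorem opNorm_nonneg (Y : Matrix (Fin n₁) (Fin n₂) ℝ) : 0 ≤ opNorm Y := norm_nonneg Y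

open scoped Matrix.Norms.L2Operator in
theorem opNorm_add_le (X Y : Matrix (Fin n₁) (Fin n₂) ℝ) :
    opNorm (X + Y) ≤ opNorm X + opNorm Y := norm_add_le X Y

open scoped Matrix.Norms.L2Operator in
theorem opNorm_neg (X : Matrix (Fin n₁) (Fin n₂) ℝ) : opNorm (-X) = opNorm X := norm_neg X

open scoped Matrix.Norms.L2Operator in
theorem opNorm_le_of_forall_mulVec {Y : Matrix (Fin n₁) (Fin n₂) ℝ} {L : ℝ} (hL : 0 ≤ L)
    (h : ∀ (u : EuclideanSpace ℝ (Fin n₁)) (v : EuclideanSpace ℝ (Fin n₂)), ‖u‖ ≤ 1 → ‖v‖ ≤ 1 →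
      u.ofLp ⬝ᵥ (Y *ᵥ v.ofLp) ≤ L) : opNorm Y ≤ L := by
  have h0 : opNorm Y = ‖toEuclideanLin.trans LinearMap.toContinuousLinearMap Y‖ :=
    l2_opNorm_def Y
  rw [h0]
  refine ContinuousLinearMap.opNorm_le_of_unit_norm hL fun v hv => ?_
  set w := toEuclideanLin.trans LinearMap.toContinuousLinearMap Y v with hw
  have hw' : w.ofLp = Y *ᵥ v.ofLp := rfl
  rcases eq_or_ne w 0 with h1 | h1
  · rw [h1, norm_zero]; exact hL
  have h2 := h (‖w‖⁻¹ • w) v (by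
    rw [norm_smul, norm_inv, norm_norm, inv_mul_cancel₀ (norm_ne_zero_iff.mpr h1)]) hv.le
  rw [← hw', WithLp.ofLp_smul, smul_dotProduct, dotProduct_self_ofLp, smul_eq_mul, sq,
    ← mul_assoc, inv_mul_cancel₀ (norm_ne_zero_iff.mpr h1), one_mul] at h2
  exact h2

open scoped Matrix.Norms.L2Operator in
theorem norm_le_one_of_transpose_mul_self {ι κ : Type*} [Fintype ι] [Fintype κ] [DecidableEq ι]
    [DecidableEq κ] {U : Matrix ι κ ℝ} (hU : Uᵀ * U = 1) : ‖U‖ ≤ 1 := by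
  have h := l2_opNorm_conjTranspose_mul_self U
  rw [conjTranspose_eq_transpose_of_trivial, hU] at h
  have h1 : ‖(1 : Matrix κ κ ℝ)‖ ≤ 1 := by
    rw [← diagonal_one, l2_opNorm_diagonal]
    exact (pi_norm_le_iff_of_nonneg zero_le_one).mpr fun i => by simp
  nlinarith [norm_nonneg U]

open scoped Matrix.Norms.L2Operator in
theorem norm_transpose_le_one {ι κ : Type*} [Fintype ι] [Fintype κ] [DecidableEq ι]
    [DecidableEq κ] {U : Matrix ι κ ℝ} (hU : Uᵀ * U = 1) : ‖Uᵀ‖ ≤ 1 := by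
  rw [← conjTranspose_eq_transpose_of_trivial, l2_opNorm_conjTranspose]
  exact norm_le_one_of_transpose_mul_self hU

open scoped Matrix.Norms.L2Operator in
theorem opNorm_mul_transpose_le_one {κ : Type*} [Fintype κ] [DecidableEq κ]
    {U : Matrix (Fin n₁) κ ℝ} {V : Matrix (Fin n₂) κ ℝ} (hU : Uᵀ * U = 1) (hV : Vᵀ * V = 1) :
    opNorm (U * Vᵀ) ≤ 1 := by
  have h : opNorm (U * Vᵀ) = ‖U * Vᵀ‖ := rfl
  rw [h]
  exact (l2_opNorm_mul U Vᵀ).trans (mul_le_one₀ (norm_le_one_of_transpose_mul_self hU)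
    (norm_nonneg _) (norm_transpose_le_one hV))

open scoped Matrix.Norms.L2Operator in
theorem abs_diag_entry_le {k : ℕ} {U : Matrix (Fin n₁) (Fin k) ℝ} {V : Matrix (Fin n₂) (Fin k) ℝ}
    (hU : Uᵀ * U = 1) (hV : Vᵀ * V = 1) (Y : Matrix (Fin n₁) (Fin n₂) ℝ) (i : Fin k) :
    |(Uᵀ * Y * V) i i| ≤ opNorm Y := by
  have hE : ‖Uᵀ * Y * V‖ ≤ opNorm Y := by
    have h0 : opNorm Y = ‖Y‖ := rfl
    have h1 := norm_transpose_le_one hU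
    have h2 := norm_le_one_of_transpose_mul_self hV
    calc ‖Uᵀ * Y * V‖ ≤ ‖Uᵀ * Y‖ * ‖V‖ := l2_opNorm_mul _ _
      _ ≤ ‖Uᵀ * Y‖ * 1 := mul_le_mul_of_nonneg_left h2 (norm_nonneg _)
      _ ≤ ‖Uᵀ‖ * ‖Y‖ := by rw [mul_one]; exact l2_opNorm_mul _ _
      _ ≤ 1 * ‖Y‖ := mul_le_mul_of_nonneg_right h1 (norm_nonneg _)
      _ = opNorm Y := by rw [one_mul, h0]
  set W := Uᵀ * Y * V
  have key : ∀ s : ℝ, |s| = 1 → s * W i i ≤ opNorm W := by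
    intro s hs
    have h := dotProduct_mulVec_le W (EuclideanSpace.single i s) (EuclideanSpace.single i 1)
    simp only [PiLp.norm_single, Real.norm_eq_abs, hs, one_mul, abs_one, mul_one] at h
    refine le_of_eq_of_le ?_ h
    simp
  refine le_trans (abs_le'.mpr ⟨?_, ?_⟩) hE
  · exact (one_mul (W i i)).symm.le.trans (key 1 abs_one)
  · exact (neg_one_mul (W i i)).symm.le.trans (key (-1) (by simp))

/-- Hölder duality: in the singular bases of `X` the pairing is a sum of singular values against
diagonal entries of `Uᵀ Y V`, each bounded by the operator norm of `Y`. -/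
theorem abs_frobInner_le (X Y : Matrix (Fin n₁) (Fin n₂) ℝ) :
    |frobInner X Y| ≤ nuclearNorm X * opNorm Y := by
  obtain ⟨U, V, hU, hV, hX⟩ := exists_svd X
  conv_lhs => rw [hX]
  rw [frobInner_mul_diagonal_mul, nuclearNorm_eq_sum, Finset.sum_mul]
  refine (Finset.abs_sum_le_sum_abs _ _).trans (Finset.sum_le_sum fun i _ => ?_)
  rw [abs_mul, abs_of_nonneg (singVal_nonneg X i)]
  exact mul_le_mul_of_nonneg_left (abs_diag_entry_le hU hV Y i) (singVal_nonneg X i)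

theorem frobInner_le_nuclearNorm {X Y : Matrix (Fin n₁) (Fin n₂) ℝ} (hY : opNorm Y ≤ 1) :
    frobInner X Y ≤ nuclearNorm X := by
  refine (le_abs_self _).trans ((abs_frobInner_le X Y).trans ?_)
  exact mul_le_of_le_one_right (Finset.sum_nonneg fun i _ => singVal_nonneg X i) hY

/-- The polar factor `U Vᵀ` attains the duality bound. The nuclear norm is thus a maximum of linear
functionals, from which its triangle inequality follows. -/
theorem exists_frobInner_eq_nuclearNorm (X : Matrix (Fin n₁) (Fin n₂) ℝ) :
    ∃ Y, opNorm Y ≤ 1 ∧ frobInner X Y = nuclearNorm X := by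
  obtain ⟨U, V, hU, hV, hX⟩ := exists_svd X
  refine ⟨U * Vᵀ, opNorm_mul_transpose_le_one hU hV, ?_⟩
  have e := congrArg (fun Z => frobInner Z (U * Vᵀ)) hX
  rw [e, frobInner_mul_diagonal_mul, nuclearNorm_eq_sum]
  have h : Uᵀ * (U * Vᵀ) * V = 1 := by
    calc _ = (Uᵀ * U) * (Vᵀ * V) := by simp only [Matrix.mul_assoc]
      _ = 1 := by rw [hU, hV, Matrix.one_mul]
  simp [h]

theorem nuclearNorm_nonneg (X : Matrix (Fin n₁) (Fin n₂) ℝ) : 0 ≤ nuclearNorm X :=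
  Finset.sum_nonneg fun i _ => singVal_nonneg X i

theorem nuclearNorm_add_le (X Y : Matrix (Fin n₁) (Fin n₂) ℝ) :
    nuclearNorm (X + Y) ≤ nuclearNorm X + nuclearNorm Y := by
  obtain ⟨W, hW, h⟩ := exists_frobInner_eq_nuclearNorm (X + Y)
  rw [← h, frobInner_add_left]
  exact add_le_add (frobInner_le_nuclearNorm hW) (frobInner_le_nuclearNorm hW)

theorem nuclearNorm_neg_le (X : Matrix (Fin n₁) (Fin n₂) ℝ) :
    nuclearNorm (-X) ≤ nuclearNorm X := by
  obtain ⟨W, hW, h⟩ := exists_frobInner_eq_nuclearNorm (-X)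
  have e : frobInner (-X) W = frobInner X (-W) := by simp [frobInner]
  rw [← h, e]
  exact frobInner_le_nuclearNorm (by rwa [opNorm_neg])

theorem nuclearNorm_smul_vecMulVec_le {t : ℝ} (ht : 0 ≤ t) {u : EuclideanSpace ℝ (Fin n₁)}
    {v : EuclideanSpace ℝ (Fin n₂)} (hu : ‖u‖ ≤ 1) (hv : ‖v‖ ≤ 1) :
    nuclearNorm (t • vecMulVec u.ofLp v.ofLp) ≤ t := by
  obtain ⟨W, hW, h⟩ := exists_frobInner_eq_nuclearNorm (t • vecMulVec u.ofLp v.ofLp)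
  rw [← h, frobInner_smul_left, frobInner_vecMulVec]
  refine mul_le_of_le_one_right ht ((dotProduct_mulVec_le W u v).trans ?_)
  exact mul_le_one₀ hu (by have := opNorm_nonneg W; positivity)
    (mul_le_one₀ hW (norm_nonneg _) hv)

theorem sq_frobNorm_eq_sum (X : Matrix (Fin n₁) (Fin n₂) ℝ) :
    frobNorm X ^ 2 = ∑ i : Fin X.rank, singVal X i ^ 2 := by
  obtain ⟨U, V, hU, hV, hX⟩ := exists_svd X
  rw [sq_frobNorm]
  conv_lhs => rw [hX, frobInner_mul_diagonal_mul_mul_diagonal_mul hU hV]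
  simp [sq]

theorem nuclearNorm_le_sqrt_mul {X : Matrix (Fin n₁) (Fin n₂) ℝ} {k : ℕ} (hk : X.rank ≤ k) :
    nuclearNorm X ≤ √k * frobNorm X := by
  have h : nuclearNorm X ^ 2 ≤ k * frobNorm X ^ 2 := by
    have h1 := sq_sum_le_card_mul_sum_sq (s := Finset.univ) (f := fun i : Fin X.rank => singVal X i)
    rw [← nuclearNorm_eq_sum, ← sq_frobNorm_eq_sum, Finset.card_univ, Fintype.card_fin] at h1
    exact h1.trans (mul_le_mul_of_nonneg_right (by exact_mod_cast hk) (sq_nonneg _))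
  refine abs_le_of_sq_le_sq' ?_ (mul_nonneg (Real.sqrt_nonneg _) (frobNorm_nonneg X)) |>.2
  rwa [mul_pow, Real.sq_sqrt (Nat.cast_nonneg k)]

theorem rank_vecMulVec_smul_le (t : ℝ) (u : Fin n₁ → ℝ) (v : Fin n₂ → ℝ) :
    (t • vecMulVec u v).rank ≤ 1 := by
  rw [← smul_vecMulVec]
  exact rank_vecMulVec_le _ _

/-! ### The adjoint -/

theorem inner_map_eq_frobInner (A : Matrix (Fin n₁) (Fin n₂) ℝ →ₗ[ℝ] EuclideanSpace ℝ (Fin m))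
    (X : Matrix (Fin n₁) (Fin n₂) ℝ) (q : EuclideanSpace ℝ (Fin m)) :
    inner ℝ (A X) q = frobInner X (adjointMap A q) := inner_map_eq_trace_adjointMap A X q

theorem adjointMap_add (A : Matrix (Fin n₁) (Fin n₂) ℝ →ₗ[ℝ] EuclideanSpace ℝ (Fin m))
    (p q : EuclideanSpace ℝ (Fin m)) :
    adjointMap A (p + q) = adjointMap A p + adjointMap A q := by
  ext k l
  simp [adjointMap, add_mul, Finset.sum_add_distrib]

theorem adjointMap_neg (A : Matrix (Fin n₁) (Fin n₂) ℝ →ₗ[ℝ] EuclideanSpace ℝ (Fin m))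
    (q : EuclideanSpace ℝ (Fin m)) : adjointMap A (-q) = -adjointMap A q := by
  ext k l
  simp [adjointMap]

theorem opNorm_adjointMap_le {A : Matrix (Fin n₁) (Fin n₂) ℝ →ₗ[ℝ] EuclideanSpace ℝ (Fin m)}
    {q : EuclideanSpace ℝ (Fin m)} {L : ℝ} (hL : 0 ≤ L)
    (h : ∀ (u : EuclideanSpace ℝ (Fin n₁)) (v : EuclideanSpace ℝ (Fin n₂)), ‖u‖ ≤ 1 → ‖v‖ ≤ 1 →
      inner ℝ (A (vecMulVec u.ofLp v.ofLp)) q ≤ L) : opNorm (adjointMap A q) ≤ L := by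
  refine opNorm_le_of_forall_mulVec hL fun u v hu hv => ?_
  rw [← frobInner_vecMulVec, ← inner_map_eq_frobInner]
  exact h u v hu hv

theorem opNorm_adjointMap_add_le (A : Matrix (Fin n₁) (Fin n₂) ℝ →ₗ[ℝ] EuclideanSpace ℝ (Fin m))
    (p q : EuclideanSpace ℝ (Fin m)) :
    opNorm (adjointMap A (p + q)) ≤ opNorm (adjointMap A p) + opNorm (adjointMap A q) := by
  rw [adjointMap_add]
  exact opNorm_add_le _ _

theorem opNorm_adjointMap_sub_le (A : Matrix (Fin n₁) (Fin n₂) ℝ →ₗ[ℝ] EuclideanSpace ℝ (Fin m))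
    (p q : EuclideanSpace ℝ (Fin m)) :
    opNorm (adjointMap A (p - q)) ≤ opNorm (adjointMap A p) + opNorm (adjointMap A q) := by
  rw [sub_eq_add_neg, adjointMap_add, adjointMap_neg, ← opNorm_neg (adjointMap A q)]
  exact opNorm_add_le _ _

/-! ### Rank -/

theorem rank_add_le (X Y : Matrix (Fin n₁) (Fin n₂) ℝ) : (X + Y).rank ≤ X.rank + Y.rank := by
  have h : LinearMap.range (X + Y).mulVecLin ≤
      LinearMap.range X.mulVecLin ⊔ LinearMap.range Y.mulVecLin := by
    rw [mulVecLin_add]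
    exact LinearMap.range_add_le _ _
  exact (Submodule.finrank_mono h).trans (Submodule.finrank_add_le_finrank_add_finrank _ _)

theorem rank_smul_le (a : ℝ) (X : Matrix (Fin n₁) (Fin n₂) ℝ) : (a • X).rank ≤ X.rank := by
  have h : a • X = (a • (1 : Matrix (Fin n₁) (Fin n₁) ℝ)) * X := by simp
  rw [h]
  exact rank_mul_le_right _ _

theorem rank_neg_le (X : Matrix (Fin n₁) (Fin n₂) ℝ) : (-X).rank ≤ X.rank := by
  rw [← neg_one_smul ℝ X]
  exact rank_smul_le _ _

theorem rank_sub_le (X Y : Matrix (Fin n₁) (Fin n₂) ℝ) : (X - Y).rank ≤ X.rank + Y.rank := by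
  rw [sub_eq_add_neg]
  exact (rank_add_le _ _).trans (Nat.add_le_add_left (rank_neg_le Y) _)

/-! ### Restricted isometry -/

theorem sq_frobNorm_smul (c : ℝ) (X : Matrix (Fin n₁) (Fin n₂) ℝ) :
    frobNorm (c • X) ^ 2 = c ^ 2 * frobNorm X ^ 2 := by
  rw [sq_frobNorm, sq_frobNorm, frobInner_smul_left, frobInner_smul_right]
  ring

section Isometry

variable (A : Matrix (Fin n₁) (Fin n₂) ℝ →ₗ[ℝ] EuclideanSpace ℝ (Fin m)) {k : ℕ}

theorem isometryConst_nonneg (k : ℕ) : 0 ≤ isometryConst A k := (isLeast_isometryConst A k).1.1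

theorem le_sq_norm_map {X : Matrix (Fin n₁) (Fin n₂) ℝ} (hX : X.rank ≤ k) :
    (1 - isometryConst A k) * frobNorm X ^ 2 ≤ ‖A X‖ ^ 2 :=
  ((isLeast_isometryConst A k).1.2 X hX).1

theorem sq_norm_map_le {X : Matrix (Fin n₁) (Fin n₂) ℝ} (hX : X.rank ≤ k) :
    ‖A X‖ ^ 2 ≤ (1 + isometryConst A k) * frobNorm X ^ 2 :=
  ((isLeast_isometryConst A k).1.2 X hX).2

/-- Images of orthogonal matrices of low rank are nearly orthogonal. -/
theorem inner_map_map_le {X Y : Matrix (Fin n₁) (Fin n₂) ℝ} (hk : X.rank + Y.rank ≤ k)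
    (h : frobInner X Y = 0) :
    inner ℝ (A X) (A Y) ≤ isometryConst A k * frobNorm X * frobNorm Y := by
  set δ := isometryConst A k
  set a := frobNorm X with ha
  set b := frobNorm Y with hb
  rcases (frobNorm_nonneg X).eq_or_lt with h0 | ha0
  · rw [eq_zero_of_frobNorm_eq_zero h0.symm, map_zero, inner_zero_left, ha, ← h0]
    simp
  rcases (frobNorm_nonneg Y).eq_or_lt with h0 | hb0
  · rw [eq_zero_of_frobNorm_eq_zero h0.symm, map_zero, inner_zero_right, hb, ← h0]
    simp
  rw [← ha] at ha0
  rw [← hb] at hb0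
  have hr : ∀ c : ℝ, (b • X + c • Y).rank ≤ k := fun c =>
    (rank_add_le _ _).trans ((add_le_add (rank_smul_le _ _) (rank_smul_le _ _)).trans hk)
  have hf : ∀ c : ℝ, frobNorm (b • X + c • Y) ^ 2 = b ^ 2 * a ^ 2 + c ^ 2 * b ^ 2 := by
    intro c
    rw [sq_frobNorm_add, sq_frobNorm_smul, sq_frobNorm_smul, frobInner_smul_left,
      frobInner_smul_right, h]
    ring
  have hA : ∀ c : ℝ, ‖A (b • X + c • Y)‖ ^ 2 =
      b ^ 2 * ‖A X‖ ^ 2 + 2 * (b * c) * inner ℝ (A X) (A Y) + c ^ 2 * ‖A Y‖ ^ 2 := by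
    intro c
    rw [map_add, map_smul, map_smul, norm_add_sq_real, real_inner_smul_left,
      real_inner_smul_right, norm_smul, norm_smul, mul_pow, mul_pow, Real.norm_eq_abs, sq_abs,
      Real.norm_eq_abs, sq_abs]
    ring
  have h1 := sq_norm_map_le A (hr a)
  have h2 := le_sq_norm_map A (hr (-a))
  rw [hf, hA] at h1 h2
  have h3 : (a * b) * inner ℝ (A X) (A Y) ≤ (a * b) * (δ * a * b) := by linarith
  exact le_of_mul_le_mul_left h3 (mul_pos ha0 hb0)

end Isometry

/-! ### Decomposition of an error matrix relative to a low-rank matrix -/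

/-- Multiplying by `V` on the right and cancelling the nonzero diagonal shows that whatever
annihilates a matrix annihilates its left singular vectors. -/
theorem mul_eq_zero_of_mul_svd_eq_zero {ι : Type*} [Fintype ι] {k : ℕ}
    {N : Matrix ι (Fin n₁) ℝ} {U : Matrix (Fin n₁) (Fin k) ℝ} {V : Matrix (Fin n₂) (Fin k) ℝ}
    {d : Fin k → ℝ} (hV : Vᵀ * V = 1) (hd : ∀ i, d i ≠ 0)
    (h : N * (U * diagonal d * Vᵀ) = 0) : N * U = 0 := by
  have h1 : N * U * diagonal d = 0 := by
    calc N * U * diagonal d = N * (U * diagonal d * Vᵀ) * V := by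
          simp only [Matrix.mul_assoc, hV, Matrix.mul_one]
      _ = 0 := by rw [h, Matrix.zero_mul]
  ext i j
  have h2 := congrFun (congrFun h1 i) j
  rw [mul_diagonal, Matrix.zero_apply] at h2
  simpa [hd j] using h2

theorem transpose_fromCols_mul_self {k t : ℕ} {U : Matrix (Fin n₁) (Fin k) ℝ}
    {W : Matrix (Fin n₁) (Fin t) ℝ} (hU : Uᵀ * U = 1) (hW : Wᵀ * W = 1) (h : Uᵀ * W = 0) :
    (fromCols U W)ᵀ * fromCols U W = 1 := by
  have h' : Wᵀ * U = 0 := by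
    have := congrArg transpose h
    simpa using this
  rw [transpose_fromCols, fromRows_mul_fromCols, hU, hW, h, h', fromBlocks_one]

/-- Nuclear norms add up for matrices with orthogonal row and column spaces. -/
theorem nuclearNorm_add_le_of_orthogonal {k t : ℕ} {U : Matrix (Fin n₁) (Fin k) ℝ}
    {V : Matrix (Fin n₂) (Fin k) ℝ} {W : Matrix (Fin n₁) (Fin t) ℝ} {Z : Matrix (Fin n₂) (Fin t) ℝ}
    (hU : Uᵀ * U = 1) (hV : Vᵀ * V = 1) (hW : Wᵀ * W = 1) (hZ : Zᵀ * Z = 1)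
    (hUW : Uᵀ * W = 0) (hVZ : Vᵀ * Z = 0) (d : Fin k → ℝ) (e : Fin t → ℝ) :
    ∑ i, d i + ∑ i, e i ≤ nuclearNorm (U * diagonal d * Vᵀ + W * diagonal e * Zᵀ) := by
  have hWU : Wᵀ * U = 0 := by simpa using congrArg transpose hUW
  -- The dual certificate is `U Vᵀ + W Zᵀ`. It equals `[U W] [V Z]ᵀ` with orthonormal columns in
  -- both factors, so its operator norm is at most one.
  have hY := opNorm_mul_transpose_le_one (transpose_fromCols_mul_self hU hW hUW)
    (transpose_fromCols_mul_self hV hZ hVZ)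
  rw [transpose_fromCols, fromCols_mul_fromRows] at hY
  refine le_trans (le_of_eq ?_) (frobInner_le_nuclearNorm hY)
  rw [frobInner_add_left, frobInner_mul_diagonal_mul, frobInner_mul_diagonal_mul]
  have h1 : Uᵀ * (U * Vᵀ + W * Zᵀ) * V = 1 := by
    rw [Matrix.mul_add, ← Matrix.mul_assoc, ← Matrix.mul_assoc, hU, hUW, Matrix.zero_mul,
      add_zero, Matrix.one_mul, hV]
  have h2 : Wᵀ * (U * Vᵀ + W * Zᵀ) * Z = 1 := by
    rw [Matrix.mul_add, ← Matrix.mul_assoc, ← Matrix.mul_assoc, hW, hWU, Matrix.zero_mul,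
      zero_add, Matrix.one_mul, hZ]
  simp [h1, h2]

/-- `H` splits into a part `H₀` of rank at most `2 * B.rank` and an orthogonal part whose row and
column spaces are orthogonal to those of `B`. -/
theorem exists_decomposition (B H : Matrix (Fin n₁) (Fin n₂) ℝ) :
    ∃ (H₀ : Matrix (Fin n₁) (Fin n₂) ℝ) (t : ℕ) (W : Matrix (Fin n₁) (Fin t) ℝ)
      (Z : Matrix (Fin n₂) (Fin t) ℝ) (d : ℕ → ℝ),
      Wᵀ * W = 1 ∧ Zᵀ * Z = 1 ∧ Antitone d ∧ (∀ i, 0 ≤ d i) ∧ (∀ i, t ≤ i → d i = 0) ∧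
      H = H₀ + W * diagonal (fun i : Fin t => d i) * Zᵀ ∧ H₀.rank ≤ 2 * B.rank ∧
      (∀ f : Fin t → ℝ, frobInner H₀ (W * diagonal f * Zᵀ) = 0) ∧
      nuclearNorm H ≤ nuclearNorm H₀ + ∑ i ∈ Finset.range t, d i ∧
      nuclearNorm B + ∑ i ∈ Finset.range t, d i ≤ nuclearNorm (B + H) + nuclearNorm H₀ := by
  obtain ⟨U, V, hU, hV, hB⟩ := exists_svd B
  -- With `P = U Uᵀ` and `Q = V Vᵀ`, this is `P H + (1 - P) H Q`, each term of rank at most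
  -- `B.rank`, and the complement is `(1 - P) H (1 - Q)`.
  set H₀ := U * (Uᵀ * H) + (H - U * (Uᵀ * H)) * V * Vᵀ with hH₀
  set Hc := (H - U * (Uᵀ * H)) - (H - U * (Uᵀ * H)) * V * Vᵀ with hHc
  have hH : H = H₀ + Hc := by rw [hH₀, hHc]; abel
  have hUG : Uᵀ * (H - U * (Uᵀ * H)) = 0 := by
    rw [Matrix.mul_sub, ← Matrix.mul_assoc, hU, Matrix.one_mul, sub_self]
  have hUc : Uᵀ * Hc = 0 := by
    rw [hHc, Matrix.mul_sub, Matrix.mul_assoc, ← Matrix.mul_assoc Uᵀ, hUG]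
    simp
  have hVc : Hc * V = 0 := by
    rw [hHc, Matrix.sub_mul, Matrix.mul_assoc _ Vᵀ, hV, Matrix.mul_one, sub_self]
  obtain ⟨W, Z, hW, hZ, hHc'⟩ := exists_svd Hc
  have hd : ∀ i : Fin Hc.rank, singVal Hc i ≠ 0 := fun i => ((singVal_pos_iff Hc i).mpr i.2).ne'
  have hUW : Uᵀ * W = 0 := by
    have h := hUc
    rw [hHc'] at h
    exact mul_eq_zero_of_mul_svd_eq_zero hZ hd h
  have hVZ : Vᵀ * Z = 0 := by
    have h := congrArg transpose hVc
    rw [hHc'] at h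
    rw [transpose_mul, transpose_zero, transpose_mul, transpose_mul, diagonal_transpose,
      transpose_transpose, ← Matrix.mul_assoc Z] at h
    exact mul_eq_zero_of_mul_svd_eq_zero hW hd h
  have hZV : Zᵀ * V = 0 := by simpa using congrArg transpose hVZ
  have hsum : ∑ i ∈ Finset.range Hc.rank, singVal Hc i = nuclearNorm Hc := by
    rw [nuclearNorm_eq_sum, Finset.sum_range]
  have hBH : nuclearNorm B + nuclearNorm Hc ≤ nuclearNorm (B + Hc) := by
    have h := nuclearNorm_add_le_of_orthogonal hU hV hW hZ hUW hVZ
      (fun i : Fin B.rank => singVal B i) (fun i : Fin Hc.rank => singVal Hc i)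
    rw [← hB, ← hHc'] at h
    rwa [nuclearNorm_eq_sum B, nuclearNorm_eq_sum Hc]
  refine ⟨H₀, Hc.rank, W, Z, singVal Hc, hW, hZ, singVal_antitone Hc, singVal_nonneg Hc,
    fun i hi => singVal_eq_zero_of_rank_le hi, ?_, ?_, fun f => ?_, ?_, ?_⟩
  · rw [← hHc']; exact hH
  · have h1 : (U * (Uᵀ * H)).rank ≤ B.rank :=
      (rank_mul_le_left _ _).trans (rank_le_width U)
    have h2 : ((H - U * (Uᵀ * H)) * V * Vᵀ).rank ≤ B.rank :=
      (rank_mul_le_right _ _).trans (rank_le_height Vᵀ)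
    have := rank_add_le (U * (Uᵀ * H)) ((H - U * (Uᵀ * H)) * V * Vᵀ)
    rw [← hH₀] at this
    omega
  · rw [hH₀, frobInner_add_left, frobInner, frobInner]
    have h1 : (U * (Uᵀ * H))ᵀ * (W * diagonal f * Zᵀ) = 0 := by
      rw [transpose_mul, Matrix.mul_assoc, Matrix.mul_assoc W, ← Matrix.mul_assoc Uᵀ, hUW]
      simp
    have h2 : (((H - U * (Uᵀ * H)) * V * Vᵀ)ᵀ * (W * diagonal f * Zᵀ)).trace = 0 := by
      rw [transpose_mul, transpose_transpose, Matrix.mul_assoc V, trace_mul_comm V,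
        Matrix.mul_assoc, Matrix.mul_assoc, hZV]
      simp
    rw [h1, h2, trace_zero, add_zero]
  · rw [hsum, hH]; exact nuclearNorm_add_le _ _
  · rw [hsum]
    refine hBH.trans ?_
    have h : B + Hc = (B + H) + -H₀ := by rw [hH]; abel
    rw [h]
    exact (nuclearNorm_add_le _ _).trans (by linarith [nuclearNorm_neg_le H₀])

/-! ### Splitting a singular value sequence into blocks of length `b` -/

/-- By monotonicity, the first entry of a block is at most every entry of the preceding block, hence
at most its average. -/
theorem sum_block_heads_le {d : ℕ → ℝ} (hd : Antitone d) (hd0 : ∀ i, 0 ≤ d i) {t : ℕ}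
    (ht : ∀ i, t ≤ i → d i = 0) (b J : ℕ) :
    ∑ j ∈ Finset.range J, b * d ((j + 1) * b) ≤ ∑ i ∈ Finset.range t, d i := by
  have h1 : ∀ J, ∑ j ∈ Finset.range J, b * d ((j + 1) * b) ≤
      ∑ i ∈ Finset.range (J * b), d i := by
    intro J
    induction J with
    | zero => simp
    | succ J ih =>
      have e : (J + 1) * b = J * b + b := Nat.succ_mul J b
      rw [Finset.sum_range_succ, e, Finset.sum_range_add]
      refine add_le_add ih ?_
      have : ∑ i ∈ Finset.range b, d (J * b + b) ≤ ∑ i ∈ Finset.range b, d (J * b + i) :=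
        Finset.sum_le_sum fun i hi => hd (by
          have := Finset.mem_range.mp hi
          omega)
      simpa using this
  refine (h1 J).trans ((Finset.sum_le_sum_of_subset_of_nonneg
    (Finset.range_mono (le_max_left (J * b) t)) fun i _ _ => hd0 i).trans_eq ?_)
  refine (Finset.sum_subset (Finset.range_mono (le_max_right _ _)) fun i _ hi => ht i ?_).symm
  simpa using hi

/-- The restriction of a sequence to the `j`-th block of length `b`. -/
noncomputable def block (d : ℕ → ℝ) (b t j : ℕ) (i : Fin t) : ℝ :=
  if (i : ℕ) / b = j then d i else 0

theorem card_block_le {b : ℕ} (hb : 0 < b) (t j : ℕ) :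
    (Finset.univ.filter fun i : Fin t => (i : ℕ) / b = j).card ≤ b := by
  have h : (Finset.univ.filter fun i : Fin t => (i : ℕ) / b = j).card ≤
      (Finset.Ico (j * b) (j * b + b)).card := by
    refine Finset.card_le_card_of_injOn Fin.val (fun i hi => ?_) Fin.val_injective.injOn
    have hi' : (i : ℕ) / b = j := by simpa using hi
    rw [Finset.coe_Ico, Set.mem_Ico]
    have h1 := (Nat.div_eq_iff hb).mp hi'
    omega
  simpa using h

theorem sum_sq_block_le {d : ℕ → ℝ} (hd : Antitone d) (hd0 : ∀ i, 0 ≤ d i) {b : ℕ} (hb : 0 < b)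
    (t j : ℕ) : ∑ i, block d b t j i * block d b t j i ≤ b * d (j * b) ^ 2 := by
  have h : ∀ i : Fin t, block d b t j i * block d b t j i ≤
      if (i : ℕ) / b = j then d (j * b) ^ 2 else 0 := by
    intro i
    unfold block
    split_ifs with hi
    · have h1 : d i ≤ d (j * b) := hd (hi ▸ Nat.div_mul_le_self _ _)
      rw [← sq]
      exact pow_le_pow_left₀ (hd0 i) h1 2
    · simp
  refine (Finset.sum_le_sum fun i _ => h i).trans ?_
  rw [← Finset.sum_filter, Finset.sum_const, nsmul_eq_mul]
  exact mul_le_mul_of_nonneg_right (by exact_mod_cast card_block_le hb t j) (sq_nonneg _)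

theorem sum_block_mul_block_of_ne (d : ℕ → ℝ) (b t : ℕ) {j k : ℕ} (h : j ≠ k) :
    ∑ i, block d b t j i * block d b t k i = 0 := by
  refine Finset.sum_eq_zero fun i _ => ?_
  unfold block
  split_ifs with h1 h2 <;> first | omega | simp

/-- Since `i / b ≤ i < t`, the range more than covers all blocks. Its length `t + 1` lets block `0`
be split off, leaving `t` tail blocks, even when `t = 0`. -/
theorem sum_range_block (d : ℕ → ℝ) (b t : ℕ) (i : Fin t) :
    ∑ j ∈ Finset.range (t + 1), block d b t j i = d i := by
  unfold block
  rw [Finset.sum_ite_eq, if_pos]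
  have := Nat.div_le_self i b
  rw [Finset.mem_range]
  omega

theorem sum_mul_diagonal_block_mul {t : ℕ} (W : Matrix (Fin n₁) (Fin t) ℝ)
    (Z : Matrix (Fin n₂) (Fin t) ℝ) (d : ℕ → ℝ) (b : ℕ) :
    W * diagonal (fun i : Fin t => d i) * Zᵀ =
      ∑ j ∈ Finset.range (t + 1), W * diagonal (block d b t j) * Zᵀ := by
  rw [← Matrix.sum_mul, ← Matrix.mul_sum]
  have h := map_sum (diagonalAddMonoidHom (Fin t) ℝ) (block d b t) (Finset.range (t + 1))
  simp only [diagonalAddMonoidHom_apply] at h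
  rw [← h]
  congr 3
  ext i
  rw [Finset.sum_apply, sum_range_block]

/-- The restricted isometry bound for error matrices in a nuclear norm cone. -/
theorem frobNorm_le_of_cone (A : Matrix (Fin n₁) (Fin n₂) ℝ →ₗ[ℝ] EuclideanSpace ℝ (Fin m))
    {r s t : ℕ} {κ L : ℝ} (hκ : 0 ≤ κ) (hs : s ≤ r)
    {H H₀ : Matrix (Fin n₁) (Fin n₂) ℝ} {W : Matrix (Fin n₁) (Fin t) ℝ}
    {Z : Matrix (Fin n₂) (Fin t) ℝ} {d : ℕ → ℝ} (hW : Wᵀ * W = 1) (hZ : Zᵀ * Z = 1)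
    (hd : Antitone d) (hd0 : ∀ i, 0 ≤ d i) (ht : ∀ i, t ≤ i → d i = 0)
    (hH : H = H₀ + W * diagonal (fun i : Fin t => d i) * Zᵀ) (hr : H₀.rank ≤ 2 * s)
    (horth : ∀ f : Fin t → ℝ, frobInner H₀ (W * diagonal f * Zᵀ) = 0)
    (hcone : ∑ i ∈ Finset.range t, d i ≤ κ * nuclearNorm H₀)
    (hL : opNorm (adjointMap A (A H)) ≤ L)
    (hδ : (1 + √2 * κ) * isometryConst A (4 * r) ≤ 1) :
    (1 - (1 + √2 * κ) * isometryConst A (4 * r)) * frobNorm H ≤ (1 + κ) * (2 * √s * L) := by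
  have hL0 : 0 ≤ L := (opNorm_nonneg _).trans hL
  set δ := isometryConst A (4 * r) with hδdef
  have hδ0 : 0 ≤ δ := isometryConst_nonneg A _
  have hnuc : nuclearNorm H₀ ≤ √(2 * s : ℕ) * frobNorm H₀ := nuclearNorm_le_sqrt_mul hr
  -- For `s = 0` the blocks would have length zero. Here `H₀ = 0`, and the cone condition forces `H
  -- = 0`.
  rcases Nat.eq_zero_or_pos s with rfl | hspos
  · have hH₀ : frobNorm H₀ = 0 := by
      have h : frobNorm H₀ ^ 2 = 0 := by
        rw [sq_frobNorm_eq_sum]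
        have h0 : H₀.rank = 0 := by omega
        exact Finset.sum_eq_zero fun i _ => absurd i.2 (by omega)
      simpa using h
    have hsum : ∑ i ∈ Finset.range t, d i ≤ 0 := by
      refine hcone.trans ?_
      refine le_trans (mul_le_mul_of_nonneg_left hnuc hκ) ?_
      simp
    have hd' : ∀ i : Fin t, d i = 0 := fun i => by
      have h := Finset.single_le_sum (f := d) (fun i _ => hd0 i) (Finset.mem_range.mpr i.2)
      exact le_antisymm (h.trans hsum) (hd0 i)
    have hHz : H = 0 := by
      rw [hH, eq_zero_of_frobNorm_eq_zero hH₀]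
      simp [hd']
    have h0 : frobNorm H = 0 := by
      have h : frobNorm H ^ 2 = 0 := by rw [hHz, sq_frobNorm]; simp [frobInner]
      simpa using h
    rw [h0]
    simp
  -- The block length equals the rank bound for `H₀`. Then `H₀ + F 0`, as well as any pair among
  -- `H₀` and the blocks, has total rank at most `4 * s ≤ 4 * r`.
  set b := 2 * s with hb
  have hbpos : 0 < b := by omega
  set F : ℕ → Matrix (Fin n₁) (Fin n₂) ℝ := fun j => W * diagonal (block d b t j) * Zᵀ with hF
  have hFrank : ∀ j, (F j).rank ≤ b := fun j => by
    refine (rank_mul_diagonal_mul_le _ _ _).trans (le_trans (Finset.card_le_card ?_)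
      (card_block_le hbpos t j))
    intro i hi
    rw [Finset.mem_filter] at hi ⊢
    refine ⟨hi.1, ?_⟩
    by_contra h
    exact hi.2 (if_neg h)
  have hFnorm : ∀ j, frobNorm (F j) ≤ √b * d (j * b) := fun j => by
    have h : frobNorm (F j) ^ 2 ≤ (√b * d (j * b)) ^ 2 := by
      rw [sq_frobNorm, hF, frobInner_mul_diagonal_mul_mul_diagonal_mul hW hZ, mul_pow,
        Real.sq_sqrt (Nat.cast_nonneg b)]
      exact sum_sq_block_le hd hd0 hbpos t j
    exact abs_le_of_sq_le_sq' h (mul_nonneg (Real.sqrt_nonneg _) (hd0 _)) |>.2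
  have hForth : ∀ j k, j ≠ k → frobInner (F j) (F k) = 0 := fun j k hjk => by
    rw [hF, frobInner_mul_diagonal_mul_mul_diagonal_mul hW hZ]
    exact sum_block_mul_block_of_ne d b t hjk
  set X := H₀ + F 0 with hX
  have hHX : H = X + ∑ j ∈ Finset.range t, F (j + 1) := by
    rw [hH, sum_mul_diagonal_block_mul W Z d b, Finset.sum_range_succ', hX, add_assoc, add_comm (F 0)]
  have hXsq : frobNorm X ^ 2 = frobNorm H₀ ^ 2 + frobNorm (F 0) ^ 2 := by
    rw [hX, sq_frobNorm_add, horth, mul_zero, add_zero]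
  have hH₀X : frobNorm H₀ ≤ frobNorm X :=
    abs_le_of_sq_le_sq' (by nlinarith [sq_nonneg (frobNorm (F 0))]) (frobNorm_nonneg X) |>.2
  -- Each tail block is at most `√b` times its head. The heads sum to at most `∑ d / b`, and the
  -- cone condition together with `‖H₀‖_* ≤ √b ‖H₀‖_F` cancels the powers of `b`.
  have htail : ∑ j ∈ Finset.range t, frobNorm (F (j + 1)) ≤ κ * frobNorm X := by
    have hsb : 0 < √(b : ℝ) := Real.sqrt_pos.mpr (by exact_mod_cast hbpos)
    have h1 : √b * ∑ j ∈ Finset.range t, frobNorm (F (j + 1)) ≤ √b * (κ * frobNorm X) := by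
      calc √b * ∑ j ∈ Finset.range t, frobNorm (F (j + 1))
          ≤ √b * ∑ j ∈ Finset.range t, √b * d ((j + 1) * b) :=
            mul_le_mul_of_nonneg_left (Finset.sum_le_sum fun j _ => hFnorm _) hsb.le
        _ = ∑ j ∈ Finset.range t, b * d ((j + 1) * b) := by
            rw [Finset.mul_sum]
            refine Finset.sum_congr rfl fun j _ => ?_
            rw [← mul_assoc, Real.mul_self_sqrt (Nat.cast_nonneg b)]
        _ ≤ ∑ i ∈ Finset.range t, d i := sum_block_heads_le hd hd0 ht b t
        _ ≤ κ * (√b * frobNorm H₀) := hcone.trans (mul_le_mul_of_nonneg_left hnuc hκ)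
        _ ≤ κ * (√b * frobNorm X) :=
            mul_le_mul_of_nonneg_left (mul_le_mul_of_nonneg_left hH₀X hsb.le) hκ
        _ = √b * (κ * frobNorm X) := by ring
    exact le_of_mul_le_mul_left h1 hsb
  have hXrank : X.rank ≤ 4 * s := by
    have := rank_add_le H₀ (F 0)
    have := hFrank 0
    rw [← hX] at *
    omega
  have hsplit : frobNorm H₀ + frobNorm (F 0) ≤ √2 * frobNorm X := by
    have h : (frobNorm H₀ + frobNorm (F 0)) ^ 2 ≤ (√2 * frobNorm X) ^ 2 := by
      rw [mul_pow, Real.sq_sqrt zero_le_two, hXsq]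
      nlinarith [sq_nonneg (frobNorm H₀ - frobNorm (F 0))]
    exact abs_le_of_sq_le_sq' h (mul_nonneg (Real.sqrt_nonneg _) (frobNorm_nonneg X)) |>.2
  -- `X` and a tail block together may have rank `6 * s`, too large for the isometry constant at `4
  -- * r`. The two summands of `X` are therefore treated separately, at the cost of the factor `√2`
  -- from `hsplit`.
  have hcross : ∀ j ∈ Finset.range t, -(√2 * δ * frobNorm X) * frobNorm (F (j + 1)) ≤
      inner ℝ (A X) (A (F (j + 1))) := by
    intro j _
    have hr' := hFrank (j + 1)
    have hneg : ∀ Y : Matrix (Fin n₁) (Fin n₂) ℝ, Y.rank ≤ b → frobInner Y (F (j + 1)) = 0 →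
        -inner ℝ (A Y) (A (F (j + 1))) ≤ δ * frobNorm Y * frobNorm (F (j + 1)) := by
      intro Y hY h0
      have h1 := inner_map_map_le A (X := (-1 : ℝ) • Y) (Y := F (j + 1)) (k := 4 * r)
        (by have := rank_smul_le (-1) Y; omega) (by rw [frobInner_smul_left, h0, mul_zero])
      have h2 : frobNorm ((-1 : ℝ) • Y) = frobNorm Y := by
        have h := sq_frobNorm_smul (-1) Y
        rw [neg_one_sq, one_mul] at h
        exact (pow_left_inj₀ (frobNorm_nonneg _) (frobNorm_nonneg _) two_ne_zero).mp h
      rw [h2, map_smul, real_inner_smul_left] at h1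
      linarith
    have h1 := hneg H₀ hr (horth _)
    have h2 := hneg (F 0) (hFrank 0) (hForth 0 (j + 1) (by omega))
    rw [hX, map_add, inner_add_left, ← hX]
    have h3 := mul_le_mul_of_nonneg_right (mul_le_mul_of_nonneg_left hsplit hδ0)
      (frobNorm_nonneg (F (j + 1)))
    linarith
  have hdual : inner ℝ (A X) (A H) ≤ 2 * √s * frobNorm X * L := by
    rw [inner_map_eq_frobInner]
    refine (le_abs_self _).trans ((abs_frobInner_le _ _).trans ?_)
    have h1 := nuclearNorm_le_sqrt_mul hXrank
    have h2 : √((4 * s : ℕ) : ℝ) = 2 * √s := by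
      rw [Nat.cast_mul, Real.sqrt_mul (by positivity)]
      congr 1
      rw [Real.sqrt_eq_iff_mul_self_eq (by positivity) (by positivity)]
      norm_num
    rw [h2] at h1
    exact mul_le_mul h1 hL (opNorm_nonneg _) ((nuclearNorm_nonneg _).trans h1)
  -- Bound `⟨A X, A H⟩` in two ways: below by `(1 - δ) ‖X‖_F²` minus the cross terms, and above by
  -- duality with `A^* A H`.
  have hmain : ((1 - (1 + √2 * κ) * δ) * frobNorm X) * frobNorm X ≤
      (2 * √s * L) * frobNorm X := by
    have h1 := le_sq_norm_map A (hXrank.trans (by omega : 4 * s ≤ 4 * r))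
    have h2 : inner ℝ (A X) (A H) = ‖A X‖ ^ 2 +
        ∑ j ∈ Finset.range t, inner ℝ (A X) (A (F (j + 1))) := by
      rw [hHX, map_add A X, inner_add_right, real_inner_self_eq_norm_sq, map_sum, inner_sum]
    have h3 := Finset.sum_le_sum hcross
    rw [← Finset.mul_sum] at h3
    have h4 := mul_le_mul_of_nonneg_left htail
      (mul_nonneg (mul_nonneg (Real.sqrt_nonneg 2) hδ0) (frobNorm_nonneg X))
    rw [← hδdef] at h1
    nlinarith [h1, h2, h3, h4, hdual]
  have hXle : (1 - (1 + √2 * κ) * δ) * frobNorm X ≤ 2 * √s * L := by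
    rcases (frobNorm_nonneg X).eq_or_lt with h0 | h0
    · rw [← h0, mul_zero]; positivity
    · exact le_of_mul_le_mul_right hmain h0
  have hHle : frobNorm H ≤ (1 + κ) * frobNorm X := by
    rw [hHX]
    refine (frobNorm_add_le _ _).trans ?_
    have := frobNorm_sum_le (Finset.range t) (fun j => F (j + 1))
    linarith
  calc (1 - (1 + √2 * κ) * δ) * frobNorm H
      ≤ (1 - (1 + √2 * κ) * δ) * ((1 + κ) * frobNorm X) :=
        mul_le_mul_of_nonneg_left hHle (by linarith)
    _ = (1 + κ) * ((1 - (1 + √2 * κ) * δ) * frobNorm X) := by ring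
    _ ≤ (1 + κ) * (2 * √s * L) := mul_le_mul_of_nonneg_left hXle (by linarith)

/-! ### A low-rank proxy for the target matrix -/

/-- Thresholding the singular values of `M` achieves the ideal bias-variance trade-off. -/
theorem exists_truncation (A : Matrix (Fin n₁) (Fin n₂) ℝ →ₗ[ℝ] EuclideanSpace ℝ (Fin m)) {k : ℕ}
    {M : Matrix (Fin n₁) (Fin n₂) ℝ} (hM : M.rank ≤ k) (hδ : isometryConst A k ≤ 1) {γ : ℝ}
    (hγ : 0 ≤ γ) :
    ∃ M₀ : Matrix (Fin n₁) (Fin n₂) ℝ, γ * M₀.rank + ‖A M₀ - A M‖ ^ 2 ≤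
      ∑ i : Fin M.rank, min γ (2 * singVal M i ^ 2) := by
  obtain ⟨U, V, hU, hV, hM'⟩ := exists_svd M
  -- Keeping a singular value costs `γ` in rank; dropping it costs at most `(1 + δ) σ_i² ≤ 2 σ_i²`
  -- in fit. The cheaper option is taken.
  set f : Fin M.rank → ℝ := fun i => if γ < 2 * singVal M i ^ 2 then singVal M i else 0 with hf
  refine ⟨U * diagonal f * Vᵀ, ?_⟩
  have hsub : U * diagonal f * Vᵀ - M =
      U * diagonal (f - fun i : Fin M.rank => singVal M i) * Vᵀ := by
    have h1 : diagonal (f - fun i : Fin M.rank => singVal M i) =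
        diagonal f - diagonal (fun i : Fin M.rank => singVal M i) := by
      rw [diagonal_sub]; rfl
    rw [h1, Matrix.mul_sub, Matrix.sub_mul, ← hM']
  have hrank : (U * diagonal f * Vᵀ - M).rank ≤ k := by
    rw [hsub]
    exact ((rank_mul_le_right _ _).trans (rank_le_height Vᵀ)).trans hM
  have h1 := sq_norm_map_le A hrank
  rw [map_sub] at h1
  have h2 : frobNorm (U * diagonal f * Vᵀ - M) ^ 2 = ∑ i, (f i - singVal M i) ^ 2 := by
    rw [hsub, sq_frobNorm, frobInner_mul_diagonal_mul_mul_diagonal_mul hU hV]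
    simp [sq]
  have h3 : γ * (U * diagonal f * Vᵀ).rank ≤
      ∑ i, if γ < 2 * singVal M (i : Fin M.rank) ^ 2 then γ else 0 := by
    rw [← Finset.sum_filter, Finset.sum_const, nsmul_eq_mul, mul_comm γ]
    refine mul_le_mul_of_nonneg_right ?_ hγ
    exact_mod_cast (rank_mul_diagonal_mul_le U V f).trans (Finset.card_le_card fun i hi => by
      rw [Finset.mem_filter] at hi ⊢
      refine ⟨hi.1, ?_⟩
      by_contra h
      exact hi.2 (if_neg h))
  have h4 : (1 + isometryConst A k) * ∑ i, (f i - singVal M i) ^ 2 ≤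
      ∑ i, 2 * (f i - singVal M i) ^ 2 := by
    rw [← Finset.mul_sum]
    exact mul_le_mul_of_nonneg_right (by linarith) (Finset.sum_nonneg fun i _ => sq_nonneg _)
  rw [h2] at h1
  refine (add_le_add h3 (h1.trans h4)).trans ?_
  rw [← Finset.sum_add_distrib]
  refine Finset.sum_le_sum fun i _ => ?_
  simp only [hf]
  split_ifs with h
  · rw [min_eq_left h.le]; simp
  · rw [min_eq_right (not_lt.mp h)]; simp

/-- A near-minimizer of the complexity functional `γ * rank X + ‖A X - A M‖²`. -/
theorem exists_proxy (A : Matrix (Fin n₁) (Fin n₂) ℝ →ₗ[ℝ] EuclideanSpace ℝ (Fin m)) {k r : ℕ}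
    {M : Matrix (Fin n₁) (Fin n₂) ℝ} (hk : 1 ≤ k) (hrk : r ≤ k) (hM : M.rank ≤ r)
    (hδ : isometryConst A k ≤ 1) {l : ℝ} (hl : 0 < l) :
    ∃ B : Matrix (Fin n₁) (Fin n₂) ℝ, B.rank ≤ r ∧
      (l / 2) ^ 2 * B.rank + ‖A B - A M‖ ^ 2 ≤
        ∑ i : Fin M.rank, min ((l / 2) ^ 2) (2 * singVal M i ^ 2) ∧
      opNorm (adjointMap A (A M - A B)) ≤ l := by
  set γ := (l / 2) ^ 2 with hγdef
  have hγ : 0 < γ := by positivity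
  obtain ⟨M₀, hM₀⟩ := exists_truncation A (hM.trans hrk) hδ hγ.le
  set K : Matrix (Fin n₁) (Fin n₂) ℝ → ℝ := fun X => γ * X.rank + ‖A X - A M‖ ^ 2 with hK
  have hK0 : ∀ X, 0 ≤ K X := fun X => by positivity
  have hbdd : BddBelow (Set.range K) := ⟨0, by rintro _ ⟨X, rfl⟩; exact hK0 X⟩
  -- No exact minimizer is needed: a slack of `γ` is affordable. Comparison with `M₀` is what bounds
  -- both `K B` and the rank of `B`.
  obtain ⟨B, hB1, hB2⟩ : ∃ B, K B ≤ K M₀ ∧ K B ≤ (⨅ X, K X) + γ := by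
    obtain ⟨X, hX⟩ := exists_lt_of_ciInf_lt (lt_add_of_pos_right (⨅ X, K X) hγ)
    rcases le_total (K X) (K M₀) with h | h
    · exact ⟨X, h, hX.le⟩
    · exact ⟨M₀, le_rfl, h.trans hX.le⟩
  refine ⟨B, ?_, hB1.trans hM₀, opNorm_adjointMap_le hl.le fun u v hu hv => ?_⟩
  · have h1 : ∑ i : Fin M.rank, min γ (2 * singVal M i ^ 2) ≤ γ * r := by
      refine (Finset.sum_le_sum fun i _ => min_le_left _ _).trans ?_
      rw [Finset.sum_const, nsmul_eq_mul, Finset.card_univ, Fintype.card_fin, mul_comm]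
      exact mul_le_mul_of_nonneg_left (by exact_mod_cast hM) hγ.le
    have h2 : γ * B.rank ≤ γ * r := by
      have := (hB1.trans hM₀).trans h1
      have h3 : 0 ≤ ‖A B - A M‖ ^ 2 := sq_nonneg _
      simp only [hK] at this
      linarith
    exact_mod_cast le_of_mul_le_mul_left h2 hγ
  · set E := vecMulVec u.ofLp v.ofLp
    set g := inner ℝ (A E) (A M - A B) with hg
    have hE : ‖A E‖ ^ 2 ≤ 2 := by
      refine (sq_norm_map_le A ((rank_vecMulVec_le _ _).trans hk)).trans ?_
      have h1 : frobNorm E ^ 2 ≤ 1 := by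
        rw [sq_frobNorm_vecMulVec, dotProduct_self_ofLp, dotProduct_self_ofLp]
        exact mul_le_one₀ (pow_le_one₀ (norm_nonneg _) hu) (sq_nonneg _)
          (pow_le_one₀ (norm_nonneg _) hv)
      have h0 := isometryConst_nonneg A k
      nlinarith [sq_nonneg (frobNorm E)]
    -- A step `τ • E` changes the fit by `-2 τ g + τ² ‖A E‖² ≤ -2 τ g + 2 τ²`, which is least at `τ
    -- = g / 2`, with value `-g² / 2`. The gain cannot exceed `2 γ`, one `γ` for the extra rank and
    -- one for the slack, so `g² ≤ 4 γ = l²`.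
    have h1 := hB2.trans (add_le_add_left (ciInf_le hbdd (B + (g / 2) • E)) γ)
    have hN : (B + (g / 2) • E).rank ≤ B.rank + 1 :=
      (rank_add_le B _).trans
        (Nat.add_le_add_left (rank_vecMulVec_smul_le (g / 2) u.ofLp v.ofLp) B.rank)
    have h2 : ((B + (g / 2) • E).rank : ℝ) ≤ B.rank + 1 := by
      rw [← Nat.cast_add_one]
      exact Nat.cast_le.mpr hN
    have h3 : ‖A (B + (g / 2) • E) - A M‖ ^ 2 =
        ‖A B - A M‖ ^ 2 - g ^ 2 + (g / 2) ^ 2 * ‖A E‖ ^ 2 := by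
      have e : A (B + (g / 2) • E) - A M = (g / 2) • A E - (A M - A B) := by
        rw [map_add, map_smul]; abel
      rw [e, norm_sub_sq_real, real_inner_smul_left, ← hg, norm_smul, mul_pow, Real.norm_eq_abs,
        sq_abs, norm_sub_rev (A M)]
      ring
    simp only [hK] at h1
    rw [h3] at h1
    have h4 : g ^ 2 ≤ l ^ 2 := by
      have h5 := mul_le_mul_of_nonneg_left h2 hγ.le
      have h6 := mul_le_mul_of_nonneg_left hE (sq_nonneg (g / 2))
      have h7 : l ^ 2 = 4 * γ := by rw [hγdef]; ring
      clear_value γ g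
      linarith
    exact abs_le_of_sq_le_sq' h4 hl.le |>.2

/-- The constant in the oracle inequality for the nuclear norm cone of aperture `κ` and dual
bound `c * l`. -/
noncomputable def oracleConst (κ c δ : ℝ) : ℝ :=
  2 * (16 * (1 + κ) ^ 2 * c ^ 2) / (1 - (1 + √2 * κ) * δ) ^ 2 + 2 / (1 - δ)

theorem sq_frobNorm_sub_le_of_proxy (A : Matrix (Fin n₁) (Fin n₂) ℝ →ₗ[ℝ] EuclideanSpace ℝ (Fin m))
    {r : ℕ} {κ θ c l S : ℝ} (hκ : 0 ≤ κ) (hθ : θ < 1) (hθκ : 1 + θ ≤ κ * (1 - θ)) (hθ0 : 0 ≤ θ)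
    {M B X : Matrix (Fin n₁) (Fin n₂) ℝ} (hM : M.rank ≤ r) (hB : B.rank ≤ r)
    (hS : (l / 2) ^ 2 * B.rank + ‖A B - A M‖ ^ 2 ≤ S)
    (hδ : (1 + √2 * κ) * isometryConst A (4 * r) < 1)
    (hcone : nuclearNorm X ≤ nuclearNorm B + θ * nuclearNorm (X - B))
    (hL : opNorm (adjointMap A (A (X - B))) ≤ c * l) :
    frobNorm (X - M) ^ 2 ≤ oracleConst κ c (isometryConst A (4 * r)) * S := by
  set δ := isometryConst A (4 * r) with hδdef
  have hδ0 : 0 ≤ δ := isometryConst_nonneg A _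
  have hδ1 : δ < 1 := by nlinarith [mul_nonneg (mul_nonneg (Real.sqrt_nonneg 2) hκ) hδ0]
  obtain ⟨H₀, t, W, Z, d, hW, hZ, hd, hd0, ht, hH, hrank, horth, hn1, hn2⟩ :=
    exists_decomposition B (X - B)
  rw [add_sub_cancel] at hn2
  -- The decomposition and `hcone` give `(1 - θ) ∑ d ≤ (1 + θ) ‖H₀‖_*`, whence the relation between
  -- `κ` and `θ`.
  have hc : ∑ i ∈ Finset.range t, d i ≤ κ * nuclearNorm H₀ := by
    have h1 := mul_le_mul_of_nonneg_left hn1 hθ0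
    have h2 := mul_le_mul_of_nonneg_right hθκ (nuclearNorm_nonneg H₀)
    have h3 : (1 - θ) * ∑ i ∈ Finset.range t, d i ≤ (1 - θ) * (κ * nuclearNorm H₀) := by linarith
    exact le_of_mul_le_mul_left h3 (by linarith)
  have h := frobNorm_le_of_cone A hκ hB hW hZ hd hd0 ht hH hrank horth hc hL hδ.le
  rw [← hδdef] at h
  set D := 1 - (1 + √2 * κ) * δ with hD
  have hDpos : 0 < D := by linarith
  have hbr : 0 ≤ ‖A B - A M‖ ^ 2 := sq_nonneg _
  have hs : (B.rank : ℝ) * l ^ 2 ≤ 4 * S := by linarith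
  have h1 : frobNorm (X - B) ^ 2 ≤ 16 * (1 + κ) ^ 2 * c ^ 2 / D ^ 2 * S := by
    rw [div_mul_eq_mul_div, le_div_iff₀ (by positivity)]
    have h2 : (D * frobNorm (X - B)) ^ 2 ≤ ((1 + κ) * (2 * √B.rank * (c * l))) ^ 2 :=
      pow_le_pow_left₀ (mul_nonneg hDpos.le (frobNorm_nonneg _)) h 2
    have h3 : ((1 + κ) * (2 * √B.rank * (c * l))) ^ 2 =
        4 * (1 + κ) ^ 2 * c ^ 2 * (B.rank * l ^ 2) := by
      rw [mul_pow, mul_pow, mul_pow, Real.sq_sqrt (Nat.cast_nonneg _)]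
      ring
    rw [h3] at h2
    have h4 := mul_le_mul_of_nonneg_left hs
      (mul_nonneg (mul_nonneg zero_le_four (sq_nonneg (1 + κ))) (sq_nonneg c))
    linarith
  have h2 : frobNorm (B - M) ^ 2 ≤ 1 / (1 - δ) * S := by
    rw [div_mul_eq_mul_div, one_mul, le_div_iff₀ (by linarith)]
    have h3 := le_sq_norm_map A ((rank_sub_le B M).trans (by omega : _ ≤ 4 * r))
    rw [map_sub, ← hδdef] at h3
    have : 0 ≤ (l / 2) ^ 2 * (B.rank : ℝ) := by positivity
    linarith
  have h3 : frobNorm (X - M) ≤ frobNorm (X - B) + frobNorm (B - M) := by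
    have := frobNorm_add_le (X - B) (B - M)
    rwa [sub_add_sub_cancel] at this
  have h4 : frobNorm (X - M) ^ 2 ≤ 2 * frobNorm (X - B) ^ 2 + 2 * frobNorm (B - M) ^ 2 := by
    have := pow_le_pow_left₀ (frobNorm_nonneg _) h3 2
    nlinarith [sq_nonneg (frobNorm (X - B) - frobNorm (B - M))]
  have h5 : oracleConst κ c δ * S =
      2 * (16 * (1 + κ) ^ 2 * c ^ 2 / D ^ 2 * S) + 2 * (1 / (1 - δ) * S) := by
    rw [oracleConst, ← hD]
    ring
  rw [h5]
  linarith

/-! ### The two estimators -/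

/-- `√2 - 1 = 1 / (1 + √2)`: this is the cone condition for `κ = 1`. -/
theorem one_add_sqrt_two_mul_lt_one {δ : ℝ} (h : δ < √2 - 1) : (1 + √2 * 1) * δ < 1 := by
  have h2 : √2 * √2 = 2 := Real.mul_self_sqrt zero_le_two
  have h3 := mul_lt_mul_of_pos_left h (by positivity : 0 < 1 + √2 * 1)
  linarith

/-- `(3 √2 - 1) (3 √2 + 1) = 17`: this is the cone condition for `κ = 3`. -/
theorem one_add_three_sqrt_two_mul_lt_one {δ : ℝ} (h : δ < (3 * √2 - 1) / 17) :
    (1 + √2 * 3) * δ < 1 := by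
  have h2 : √2 * √2 = 2 := Real.mul_self_sqrt zero_le_two
  have h3 := mul_lt_mul_of_pos_left h (by positivity : 0 < 1 + √2 * 3)
  linarith

theorem three_sqrt_two_sub_one_div_lt : (3 * √2 - 1) / 17 < √2 - 1 := by
  have h : (1.4 : ℝ) < √2 := Real.lt_sqrt_of_sq_lt (by norm_num)
  linarith

theorem IsDantzigSolution.sq_frobNorm_sub_le
    {A : Matrix (Fin n₁) (Fin n₂) ℝ →ₗ[ℝ] EuclideanSpace ℝ (Fin m)} {r : ℕ}
    {M X : Matrix (Fin n₁) (Fin n₂) ℝ} (hr : 1 ≤ r) (hM : M.rank ≤ r)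
    (hδ : isometryConst A (4 * r) < √2 - 1) {l : ℝ} (hl : 0 < l) {z : EuclideanSpace ℝ (Fin m)}
    (hz : opNorm (adjointMap A z) ≤ l) (hX : IsDantzigSolution A (A M + z) (2 * l) X) :
    frobNorm (X - M) ^ 2 ≤ oracleConst 1 4 (isometryConst A (4 * r)) *
      ∑ i : Fin M.rank, min ((l / 2) ^ 2) (2 * singVal M i ^ 2) := by
  have hs2 : √2 < 2 := by rw [Real.sqrt_lt' (by norm_num)]; norm_num
  obtain ⟨B, hB, hS, hBM⟩ := exists_proxy A (k := 4 * r) (by omega) (by omega) hM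
    (by linarith) hl
  have hfeas : opNorm (adjointMap A (A M + z - A B)) ≤ 2 * l := by
    have e : A M + z - A B = (A M - A B) + z := by abel
    rw [e]
    linarith [opNorm_adjointMap_add_le A (A M - A B) z]
  -- Feasibility of `B` gives `‖X‖_* ≤ ‖B‖_*`, so `θ = 0` and `κ = 1`. The dual bound `4 l` adds the
  -- two residual bounds `2 l`.
  refine sq_frobNorm_sub_le_of_proxy A zero_le_one (θ := 0) one_pos (by norm_num) le_rfl hM
    hB hS (one_add_sqrt_two_mul_lt_one hδ) ?_ ?_
  · rw [zero_mul, add_zero]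
    exact hX.2 B hfeas
  · have e : A (X - B) = (A M + z - A B) - (A M + z - A X) := by rw [map_sub]; abel
    rw [e]
    linarith [opNorm_adjointMap_sub_le A (A M + z - A B) (A M + z - A X), hX.1]

/-- The first-order optimality condition for the matrix Lasso. -/
theorem IsLassoSolution.opNorm_adjointMap_le
    {A : Matrix (Fin n₁) (Fin n₂) ℝ →ₗ[ℝ] EuclideanSpace ℝ (Fin m)}
    {X : Matrix (Fin n₁) (Fin n₂) ℝ} {y : EuclideanSpace ℝ (Fin m)} {μ : ℝ} (hμ : 0 ≤ μ)
    (hX : IsLassoSolution A y μ X) : opNorm (adjointMap A (y - A X)) ≤ μ := by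
  refine MatrixRecovery.opNorm_adjointMap_le hμ fun u v hu hv => ?_
  set E := vecMulVec u.ofLp v.ofLp
  refine le_of_forall_pos_le_add fun ε hε => ?_
  -- Moving by `t • E` raises the penalty by at most `μ t`. After division by `t` the quadratic
  -- remainder is `t ‖A E‖² / 2`, which this choice keeps below `ε`.
  set t := ε / (‖A E‖ ^ 2 + 1) with ht
  have htpos : 0 < t := by positivity
  have h1 := hX (X + t • E)
  have h2 : nuclearNorm (X + t • E) ≤ nuclearNorm X + t :=
    (nuclearNorm_add_le _ _).trans
      (add_le_add_right (nuclearNorm_smul_vecMulVec_le htpos.le hu hv) _)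
  have h3 : ‖A (X + t • E) - y‖ ^ 2 = ‖A X - y‖ ^ 2 - 2 * t * inner ℝ (A E) (y - A X) +
      t ^ 2 * ‖A E‖ ^ 2 := by
    have e : A (X + t • E) - y = t • A E - (y - A X) := by
      rw [map_add, map_smul]; abel
    rw [e, norm_sub_sq_real, real_inner_smul_left, norm_smul, mul_pow, Real.norm_eq_abs, sq_abs,
      norm_sub_rev y]
    ring
  rw [h3] at h1
  have h4 := mul_le_mul_of_nonneg_left h2 hμ
  have h5 : t * inner ℝ (A E) (y - A X) ≤ t * (μ + t * ‖A E‖ ^ 2 / 2) := by linarith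
  refine (le_of_mul_le_mul_left h5 htpos).trans (add_le_add_right ?_ _)
  have h6 : t * (‖A E‖ ^ 2 + 1) = ε := by rw [ht]; field_simp
  nlinarith [sq_nonneg ‖A E‖]

theorem IsLassoSolution.sq_frobNorm_sub_le
    {A : Matrix (Fin n₁) (Fin n₂) ℝ →ₗ[ℝ] EuclideanSpace ℝ (Fin m)} {r : ℕ}
    {M X : Matrix (Fin n₁) (Fin n₂) ℝ} (hr : 1 ≤ r) (hM : M.rank ≤ r)
    (hδ : isometryConst A (4 * r) < (3 * √2 - 1) / 17) {l : ℝ} (hl : 0 < l)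
    {z : EuclideanSpace ℝ (Fin m)} (hz : opNorm (adjointMap A z) ≤ l)
    (hX : IsLassoSolution A (A M + z) (4 * l) X) :
    frobNorm (X - M) ^ 2 ≤ oracleConst 3 6 (isometryConst A (4 * r)) *
      ∑ i : Fin M.rank, min ((l / 2) ^ 2) (2 * singVal M i ^ 2) := by
  have hs2 : √2 < 2 := by rw [Real.sqrt_lt' (by norm_num)]; norm_num
  obtain ⟨B, hB, hS, hBM⟩ := exists_proxy A (k := 4 * r) (by omega) (by omega) hM
    (by linarith) hl
  have hfeas : opNorm (adjointMap A (A M + z - A B)) ≤ 2 * l := by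
    have e : A M + z - A B = (A M - A B) + z := by abel
    rw [e]
    linarith [opNorm_adjointMap_add_le A (A M - A B) z]
  -- Here `θ` is the residual bound `2 l` of `B` over the penalty `4 l`, so `κ = 3`. The dual bound
  -- `6 l` adds `2 l` for `B` and `4 l` for the Lasso solution.
  refine sq_frobNorm_sub_le_of_proxy A (by norm_num) (θ := 1 / 2) (by norm_num) (by norm_num)
    (by norm_num) hM hB hS (one_add_three_sqrt_two_mul_lt_one hδ) ?_ ?_
  · have h1 := hX B
    have h2 : ‖A X - (A M + z)‖ ^ 2 = ‖A (X - B)‖ ^ 2 -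
        2 * inner ℝ (A (X - B)) (A M + z - A B) + ‖A B - (A M + z)‖ ^ 2 := by
      have e : A X - (A M + z) = A (X - B) - (A M + z - A B) := by rw [map_sub]; abel
      rw [e, norm_sub_sq_real, norm_sub_rev (A B)]
    rw [h2] at h1
    have h3 : inner ℝ (A (X - B)) (A M + z - A B) ≤ nuclearNorm (X - B) * (2 * l) := by
      rw [inner_map_eq_frobInner]
      exact (le_abs_self _).trans ((abs_frobInner_le _ _).trans
        (mul_le_mul_of_nonneg_left hfeas (nuclearNorm_nonneg _)))
    have h4 : (4 * l) * nuclearNorm X ≤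
        (4 * l) * (nuclearNorm B + 1 / 2 * nuclearNorm (X - B)) := by
      linarith [sq_nonneg ‖A (X - B)‖]
    exact le_of_mul_le_mul_left h4 (by linarith)
  · have e : A (X - B) = (A M + z - A B) - (A M + z - A X) := by rw [map_sub]; abel
    rw [e]
    linarith [opNorm_adjointMap_sub_le A (A M + z - A B) (A M + z - A X),
      hX.opNorm_adjointMap_le (by linarith)]

/-! ### Nets of the Euclidean unit ball -/

/-- A volumetric bound on `1/4`-separated subsets of the unit ball. -/
theorem card_le_of_separated_unitBall {n : ℕ} (s : Finset (EuclideanSpace ℝ (Fin n)))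
    (hs : ∀ c ∈ s, ‖c‖ ≤ 1) (h : ∀ c ∈ s, ∀ d ∈ s, c ≠ d → 1 / 4 ≤ ‖c - d‖) :
    s.card ≤ 9 ^ n := by
  let ν : Measure (EuclideanSpace ℝ (Fin n)) := volume
  have hδ : (0 : ℝ) < 1 / 8 := by norm_num
  have hρ : (0 : ℝ) < 9 / 8 := by norm_num
  have hdisj : Set.Pairwise (s : Set (EuclideanSpace ℝ (Fin n)))
      (Function.onFun Disjoint fun c => Metric.ball c (1 / 8)) := by
    rintro c hc d hd hcd
    apply Metric.ball_disjoint_ball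
    rw [dist_eq_norm]
    have := h c hc d hd hcd
    linarith
  have hsub : (⋃ c ∈ s, Metric.ball c (1 / 8)) ⊆
      Metric.ball (0 : EuclideanSpace ℝ (Fin n)) (9 / 8) := by
    refine Set.iUnion₂_subset fun x hx => Metric.ball_subset_ball' ?_
    rw [dist_zero_right]
    have := hs x hx
    linarith
  -- The balls of radius `1/8` about the points are disjoint and lie in the ball of radius `9/8`;
  -- the ratio of volumes is `9 ^ n`.
  have hI : (s.card : ENNReal) * ENNReal.ofReal ((1 / 8) ^ n) * ν (Metric.ball 0 1) ≤
      ENNReal.ofReal ((9 / 8) ^ n) * ν (Metric.ball 0 1) := by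
    have h1 := measure_mono (μ := ν) hsub
    rw [measure_biUnion_finset hdisj fun c _ => measurableSet_ball,
      Measure.addHaar_ball_of_pos ν _ hρ] at h1
    simp only [Measure.addHaar_ball_of_pos ν _ hδ, Finset.sum_const, nsmul_eq_mul,
      finrank_euclideanSpace_fin] at h1
    rwa [mul_assoc]
  have hJ : (s.card : ENNReal) * ENNReal.ofReal ((1 / 8) ^ n) ≤ ENNReal.ofReal ((9 / 8) ^ n) :=
    (ENNReal.mul_le_mul_iff_left (Metric.measure_ball_pos _ _ zero_lt_one).ne'
      measure_ball_lt_top.ne).1 hI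
  have hK := ENNReal.toReal_le_of_le_ofReal (by positivity) hJ
  rw [ENNReal.toReal_mul, ENNReal.toReal_natCast, ENNReal.toReal_ofReal (by positivity),
    one_div, inv_pow, ← div_eq_mul_inv, div_le_iff₀ (by positivity), ← mul_pow] at hK
  norm_num at hK
  exact_mod_cast hK

/-- A `1/4`-separated set of largest cardinality is a net, since an uncovered point could be added
to it. The volumetric bound makes that maximum exist. -/
theorem exists_net (n : ℕ) : ∃ N : Finset (EuclideanSpace ℝ (Fin n)), (∀ c ∈ N, ‖c‖ ≤ 1) ∧
    N.card ≤ 9 ^ n ∧ ∀ x : EuclideanSpace ℝ (Fin n), ‖x‖ ≤ 1 → ∃ c ∈ N, ‖x - c‖ ≤ 1 / 4 := by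
  classical
  let P : ℕ → Prop := fun k => ∃ N : Finset (EuclideanSpace ℝ (Fin n)), (∀ c ∈ N, ‖c‖ ≤ 1) ∧
    (∀ c ∈ N, ∀ d ∈ N, c ≠ d → 1 / 4 ≤ ‖c - d‖) ∧ N.card = k
  have h0 : P 0 := ⟨∅, by simp, by simp, rfl⟩
  obtain ⟨N, hN1, hN2, hN3⟩ : P (Nat.findGreatest P (9 ^ n)) :=
    Nat.findGreatest_spec (Nat.zero_le _) h0
  refine ⟨N, hN1, card_le_of_separated_unitBall N hN1 hN2, fun x hx => ?_⟩
  by_contra! hcon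
  have hxN : x ∉ N := fun hxN => by
    have := hcon x hxN
    rw [sub_self, norm_zero] at this
    linarith
  have hins1 : ∀ c ∈ insert x N, ‖c‖ ≤ 1 := by
    intro c hc
    rcases Finset.mem_insert.mp hc with rfl | hc
    · exact hx
    · exact hN1 c hc
  have hins2 : ∀ c ∈ insert x N, ∀ d ∈ insert x N, c ≠ d → 1 / 4 ≤ ‖c - d‖ := by
    intro c hc d hd hcd
    rcases Finset.mem_insert.mp hc with rfl | hc' <;> rcases Finset.mem_insert.mp hd with rfl | hd'
    · exact absurd rfl hcd
    · exact (hcon d hd').le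
    · rw [norm_sub_rev]; exact (hcon c hc').le
    · exact hN2 c hc' d hd' hcd
  have hcard := card_le_of_separated_unitBall _ hins1 hins2
  have hP : P (N.card + 1) := ⟨insert x N, hins1, hins2, Finset.card_insert_of_notMem hxN⟩
  rw [Finset.card_insert_of_notMem hxN] at hcard
  have := Nat.le_findGreatest hcard hP
  omega

/-- The operator norm is at most twice the maximum of the bilinear form over `1/4`-nets. -/
theorem opNorm_le_two_mul_of_net {Y : Matrix (Fin n₁) (Fin n₂) ℝ} {b : ℝ} (hb : 0 ≤ b)
    {N₁ : Finset (EuclideanSpace ℝ (Fin n₁))} {N₂ : Finset (EuclideanSpace ℝ (Fin n₂))}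
    (h₂ : ∀ c ∈ N₂, ‖c‖ ≤ 1)
    (h₁' : ∀ x : EuclideanSpace ℝ (Fin n₁), ‖x‖ ≤ 1 → ∃ c ∈ N₁, ‖x - c‖ ≤ 1 / 4)
    (h₂' : ∀ x : EuclideanSpace ℝ (Fin n₂), ‖x‖ ≤ 1 → ∃ c ∈ N₂, ‖x - c‖ ≤ 1 / 4)
    (h : ∀ u ∈ N₁, ∀ v ∈ N₂, u.ofLp ⬝ᵥ (Y *ᵥ v.ofLp) ≤ b) : opNorm Y ≤ 2 * b := by
  have hY := opNorm_nonneg Y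
  -- Replacing `u` and `v` by net points costs `opNorm Y / 4` each, and the total is absorbed on the
  -- left.
  have key : opNorm Y ≤ b + opNorm Y / 2 := by
    refine opNorm_le_of_forall_mulVec (by linarith) fun u v hu hv => ?_
    obtain ⟨c, hc, huc⟩ := h₁' u hu
    obtain ⟨d, hd, hvd⟩ := h₂' v hv
    have e : u.ofLp ⬝ᵥ (Y *ᵥ v.ofLp) = c.ofLp ⬝ᵥ (Y *ᵥ d.ofLp) +
        (u - c).ofLp ⬝ᵥ (Y *ᵥ d.ofLp) + u.ofLp ⬝ᵥ (Y *ᵥ (v - d).ofLp) := by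
      rw [WithLp.ofLp_sub, WithLp.ofLp_sub, sub_dotProduct, mulVec_sub, dotProduct_sub]
      ring
    have h1 : (u - c).ofLp ⬝ᵥ (Y *ᵥ d.ofLp) ≤ 1 / 4 * (opNorm Y * 1) :=
      (dotProduct_mulVec_le Y _ _).trans (mul_le_mul huc
        (mul_le_mul_of_nonneg_left (h₂ d hd) hY) (by positivity) (by norm_num))
    have h2 : u.ofLp ⬝ᵥ (Y *ᵥ (v - d).ofLp) ≤ 1 * (opNorm Y * (1 / 4)) :=
      (dotProduct_mulVec_le Y _ _).trans (mul_le_mul hu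
        (mul_le_mul_of_nonneg_left hvd hY) (by positivity) zero_le_one)
    have h3 := h c hc d hd
    linarith
  linarith

/-! ### Gaussian noise -/

section Noise

variable {Ω : Type*} [MeasurableSpace Ω] {P : Measure Ω} {σ : ℝ} {z : Ω → EuclideanSpace ℝ (Fin m)}

theorem hasSubgaussianMGF_of_hasLaw_gaussianReal {X : Ω → ℝ} {v : NNReal}
    (h : HasLaw X (gaussianReal 0 v) P) : HasSubgaussianMGF X v P where
  integrable_exp_mul t := by
    have h1 := integrable_exp_mul_gaussianReal (μ := 0) (v := v) t
    rw [← h.map_eq] at h1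
    exact h1.comp_aemeasurable h.aemeasurable
  mgf_le t := by
    rw [mgf_gaussianReal h.map_eq, zero_mul, zero_add]

theorem IsGaussianNoise.measureReal_le_inner (hz : IsGaussianNoise P σ z)
    (w : EuclideanSpace ℝ (Fin m)) {b ε : ℝ} (hw : ‖w‖ ^ 2 ≤ b) (hε : 0 ≤ ε) :
    P.real {ω | ε ≤ inner ℝ w (z ω)} ≤ Real.exp (-ε ^ 2 / (2 * (b * σ ^ 2))) := by
  have hind : iIndepFun (fun i ω => w i * z ω i) P :=
    hz.2.comp (fun i x => w i * x) fun i => measurable_const_mul (w i)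
  have hi : ∀ i, HasSubgaussianMGF (fun ω => w i * z ω i)
      (Real.toNNReal (w i ^ 2) * Real.toNNReal (σ ^ 2)) P := fun i => by
    rw [Real.toNNReal_of_nonneg (sq_nonneg (w i))]
    exact (hasSubgaussianMGF_of_hasLaw_gaussianReal (hz.1 i)).const_mul (w i)
  have hsum := HasSubgaussianMGF.sum_of_iIndepFun (s := Finset.univ) hind fun i _ => hi i
  have hin : (fun ω => ∑ i, w i * z ω i) = fun ω => inner ℝ w (z ω) := by
    funext ω
    rw [← dotProduct_eq_inner, dotProduct]
  rw [hin] at hsum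
  have hb : 0 ≤ b * σ ^ 2 := mul_nonneg ((sq_nonneg _).trans hw) (sq_nonneg _)
  obtain ⟨c, hc, hle⟩ : ∃ c : NNReal, HasSubgaussianMGF (fun ω => inner ℝ w (z ω)) c P ∧
      (c : ℝ) ≤ b * σ ^ 2 := by
    refine ⟨_, hsum, ?_⟩
    rw [← Finset.sum_mul, NNReal.coe_mul, Real.coe_toNNReal _ (sq_nonneg σ), NNReal.coe_sum]
    refine mul_le_mul_of_nonneg_right (le_of_eq_of_le ?_ hw) (sq_nonneg σ)
    rw [EuclideanSpace.norm_sq_eq]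
    simp [Real.coe_toNNReal _ (sq_nonneg _)]
  -- The variance proxy `‖w‖² σ²` is enlarged to `b σ²` before the tail bound, so the resulting
  -- exponent is uniform in `w`.
  have hbig : HasSubgaussianMGF (fun ω => inner ℝ w (z ω)) (Real.toNNReal (b * σ ^ 2)) P :=
    ⟨hc.integrable_exp_mul, fun t => (hc.mgf_le t).trans (Real.exp_le_exp.mpr (by
      rw [Real.coe_toNNReal _ hb]
      have := mul_le_mul_of_nonneg_right hle (sq_nonneg t)
      linarith))⟩
  have h := hbig.measure_ge_le hε
  rwa [Real.coe_toNNReal _ hb] at h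

/-- With overwhelming probability the back-projected noise has operator norm at most
`8 √n σ`. -/
theorem IsGaussianNoise.exists_event_opNorm_adjointMap_le [IsProbabilityMeasure P]
    (hz : IsGaussianNoise P σ z) (hσ : 0 < σ)
    {A : Matrix (Fin n₁) (Fin n₂) ℝ →ₗ[ℝ] EuclideanSpace ℝ (Fin m)} {k : ℕ} (hk : 1 ≤ k)
    (hδ : isometryConst A k < √2 - 1) :
    ∃ E : Set Ω, MeasurableSet E ∧
      1 - Real.exp (-(1 / 2) * (max n₁ n₂ : ℕ)) ≤ P.real E ∧
      ∀ ω ∈ E, opNorm (adjointMap A (z ω)) ≤ 8 * √(max n₁ n₂ : ℕ) * σ := by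
  obtain ⟨N₁, h1, h1c, h1n⟩ := exists_net n₁
  obtain ⟨N₂, h2, h2c, h2n⟩ := exists_net n₂
  set n := max n₁ n₂ with hn
  have hs : 11 / 8 < √2 := Real.lt_sqrt_of_sq_lt (by norm_num)
  have hs2 : √2 * √2 = 2 := Real.mul_self_sqrt zero_le_two
  set a : ℝ := 4 * √(n : ℝ) * σ with ha
  have ha0 : 0 ≤ a := by positivity
  let bad : Set Ω := ⋃ p ∈ N₁ ×ˢ N₂, {ω | a ≤ inner ℝ (A (vecMulVec p.1.ofLp p.2.ofLp)) (z ω)}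
  have htail : ∀ p ∈ N₁ ×ˢ N₂, P.real {ω | a ≤ inner ℝ (A (vecMulVec p.1.ofLp p.2.ofLp)) (z ω)} ≤
      Real.exp (-(11 / 2) * n) := by
    intro p hp
    rw [Finset.mem_product] at hp
    have hA : ‖A (vecMulVec p.1.ofLp p.2.ofLp)‖ ^ 2 ≤ √2 := by
      refine (sq_norm_map_le A ((rank_vecMulVec_le _ _).trans hk)).trans ?_
      have hf : frobNorm (vecMulVec p.1.ofLp p.2.ofLp) ^ 2 ≤ 1 := by
        rw [sq_frobNorm_vecMulVec, dotProduct_self_ofLp, dotProduct_self_ofLp]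
        exact mul_le_one₀ (pow_le_one₀ (norm_nonneg _) (h1 _ hp.1)) (sq_nonneg _)
          (pow_le_one₀ (norm_nonneg _) (h2 _ hp.2))
      have h0 := isometryConst_nonneg A k
      exact (mul_le_of_le_one_right (by linarith) hf).trans (by linarith)
    refine (hz.measureReal_le_inner _ hA ha0).trans (Real.exp_le_exp.mpr ?_)
    -- From `√2 > 11/8`, each tail is at most `exp (-(11/2) n)`. Against `81 ^ n ≤ exp (5 n)` pairs
    -- this leaves `exp (-n / 2)`.
    have e : -a ^ 2 / (2 * (√2 * σ ^ 2)) = -(4 * √2) * n := by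
      rw [ha, mul_pow, mul_pow, Real.sq_sqrt (Nat.cast_nonneg n), div_eq_iff (by positivity)]
      linear_combination (8 * n * σ ^ 2) * hs2
    rw [e]
    exact mul_le_mul_of_nonneg_right (by linarith) (Nat.cast_nonneg n)
  have hbad : P.real bad ≤ Real.exp (-(1 / 2) * n) := by
    have hcard : ((N₁ ×ˢ N₂).card : ℝ) ≤ 81 ^ n := by
      rw [Finset.card_product]
      have h3 : N₁.card * N₂.card ≤ 9 ^ n * 9 ^ n :=
        Nat.mul_le_mul (h1c.trans (Nat.pow_le_pow_right (by norm_num) (le_max_left _ _)))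
          (h2c.trans (Nat.pow_le_pow_right (by norm_num) (le_max_right _ _)))
      rw [← mul_pow] at h3
      exact_mod_cast h3
    have h81 : (81 : ℝ) ^ n ≤ Real.exp (5 * n) := by
      rw [mul_comm, Real.exp_nat_mul]
      refine pow_le_pow_left₀ (by norm_num) ?_ n
      have h3 := Real.exp_one_gt_d9
      have h4 : Real.exp 5 = Real.exp 1 ^ 5 := by rw [← Real.exp_nat_mul]; norm_num
      rw [h4]
      calc (81 : ℝ) ≤ 2.7 ^ 5 := by norm_num
        _ ≤ Real.exp 1 ^ 5 := pow_le_pow_left₀ (by norm_num) (by linarith) 5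
    calc P.real bad
        ≤ ∑ p ∈ N₁ ×ˢ N₂, P.real {ω | a ≤ inner ℝ (A (vecMulVec p.1.ofLp p.2.ofLp)) (z ω)} :=
          measureReal_biUnion_finset_le _ _
      _ ≤ ∑ p ∈ N₁ ×ˢ N₂, Real.exp (-(11 / 2) * n) := Finset.sum_le_sum htail
      _ = (N₁ ×ˢ N₂).card * Real.exp (-(11 / 2) * n) := by
          rw [Finset.sum_const, nsmul_eq_mul]
      _ ≤ Real.exp (5 * n) * Real.exp (-(11 / 2) * n) :=
          mul_le_mul_of_nonneg_right (hcard.trans h81) (Real.exp_pos _).le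
      _ = Real.exp (-(1 / 2) * n) := by
          rw [← Real.exp_add]
          congr 1
          ring
  -- The noise coordinates are only almost everywhere measurable, so `bad` is replaced by a
  -- measurable hull of the same measure.
  refine ⟨(toMeasurable P bad)ᶜ, (measurableSet_toMeasurable P bad).compl, ?_, fun ω hω => ?_⟩
  · rw [probReal_compl_eq_one_sub (measurableSet_toMeasurable P bad)]
    have : P.real (toMeasurable P bad) = P.real bad := by
      rw [measureReal_def, measureReal_def, measure_toMeasurable]
    rw [this]
    linarith
  · have hω' : ω ∉ bad := fun h => hω (subset_toMeasurable P bad h)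
    have h3 : ∀ u ∈ N₁, ∀ v ∈ N₂, u.ofLp ⬝ᵥ (adjointMap A (z ω) *ᵥ v.ofLp) ≤ a := by
      intro u hu v hv
      rw [← frobInner_vecMulVec, ← inner_map_eq_frobInner]
      by_contra h
      exact hω' (Set.mem_biUnion (Finset.mem_coe.mpr (Finset.mk_mem_product hu hv))
        (not_le.mp h).le)
    refine (opNorm_le_two_mul_of_net ha0 h2 h1n h2n h3).trans_eq ?_
    rw [ha]
    ring

end Noise

/-! ### The oracle inequalities -/

/-- With `l = 8 √n σ` the rank price `(l/2)²` equals `16 n σ²`, which dominates the factor `2` on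
the other side of the minimum. -/
theorem sum_min_le_oracleRisk (M : Matrix (Fin n₁) (Fin n₂) ℝ) (σ : ℝ) :
    ∑ i : Fin M.rank, min ((8 * √(max n₁ n₂ : ℕ) * σ / 2) ^ 2) (2 * singVal M i ^ 2) ≤
      16 * oracleRisk M σ := by
  rw [← Finset.sum_range (fun i =>
    min ((8 * √(max n₁ n₂ : ℕ) * σ / 2) ^ 2) (2 * singVal M i ^ 2)), oracleRisk, Finset.mul_sum]
  have e : (8 * √(max n₁ n₂ : ℕ) * σ / 2) ^ 2 = 16 * ((max n₁ n₂ : ℕ) * σ ^ 2) := by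
    rw [div_pow, mul_pow, mul_pow, Real.sq_sqrt (Nat.cast_nonneg _)]
    ring
  rw [e]
  have hnn : 0 ≤ ((max n₁ n₂ : ℕ) : ℝ) * σ ^ 2 := by positivity
  refine (Finset.sum_le_sum_of_subset_of_nonneg (Finset.range_mono (rank_le_min M))
    fun i _ _ => le_min (by linarith) (by positivity)).trans (Finset.sum_le_sum fun i _ => ?_)
  rw [mul_min_of_nonneg _ _ (by norm_num : (0 : ℝ) ≤ 16), min_comm]
  exact min_le_min (by linarith [sq_nonneg (singVal M i)]) le_rfl

theorem oracleConst_nonneg {κ c δ : ℝ} (hδ : δ < 1) : 0 ≤ oracleConst κ c δ :=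
  add_nonneg (by positivity) (div_nonneg zero_le_two (by linarith))

end MatrixRecovery

theorem mainTheorem2 :
    ∃ (c : ℝ) (C₀ C₁ : ℝ → ℝ), 0 < c ∧
      ∀ (n₁ n₂ m r : ℕ)
        (A : Matrix (Fin n₁) (Fin n₂) ℝ →ₗ[ℝ] EuclideanSpace ℝ (Fin m))
        (M : Matrix (Fin n₁) (Fin n₂) ℝ) (σ : ℝ)
        (Ω : Type*) [MeasurableSpace Ω] (P : Measure Ω) [IsProbabilityMeasure P]
        (z : Ω → EuclideanSpace ℝ (Fin m)),
        1 ≤ r → M.rank ≤ r → 0 < σ → MatrixRecovery.IsGaussianNoise P σ z →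
        ∃ E : Set Ω, MeasurableSet E ∧
          1 - 2 * Real.exp (-c * (max n₁ n₂ : ℕ)) ≤ P.real E ∧
          ∀ ω ∈ E,
            (MatrixRecovery.isometryConst A (4 * r) < √2 - 1 →
              ∀ Mhat : Matrix (Fin n₁) (Fin n₂) ℝ,
                MatrixRecovery.IsDantzigSolution A (A M + z ω)
                  (16 * √(max n₁ n₂ : ℕ) * σ) Mhat →
                MatrixRecovery.frobNorm (Mhat - M) ^ 2 ≤
                  C₀ (MatrixRecovery.isometryConst A (4 * r)) *
                    MatrixRecovery.oracleRisk M σ) ∧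
            (MatrixRecovery.isometryConst A (4 * r) < (3 * √2 - 1) / 17 →
              ∀ Mhat : Matrix (Fin n₁) (Fin n₂) ℝ,
                MatrixRecovery.IsLassoSolution A (A M + z ω)
                  (32 * √(max n₁ n₂ : ℕ) * σ) Mhat →
                MatrixRecovery.frobNorm (Mhat - M) ^ 2 ≤
                  C₁ (MatrixRecovery.isometryConst A (4 * r)) *
                    MatrixRecovery.oracleRisk M σ) := by
  refine ⟨1 / 2, fun δ => 16 * MatrixRecovery.oracleConst 1 4 δ,
    fun δ => 16 * MatrixRecovery.oracleConst 3 6 δ, by norm_num, ?_⟩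
  intro n₁ n₂ m r A M σ Ω _ P _ z hr hM hσ hz
  have hlt := MatrixRecovery.three_sqrt_two_sub_one_div_lt
  -- The Lasso threshold is the smaller one, so when this fails both claims are vacuous.
  by_cases hδ : MatrixRecovery.isometryConst A (4 * r) < √2 - 1
  swap
  · refine ⟨Set.univ, MeasurableSet.univ, ?_, fun ω _ =>
      ⟨fun h => absurd h hδ, fun h => absurd (h.trans hlt) hδ⟩⟩
    rw [probReal_univ]
    linarith [Real.exp_pos (-(1 / 2) * (max n₁ n₂ : ℕ))]
  -- For `n = 0` the level `l` vanishes while the proxy needs `l > 0`; all matrices are then empty.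
  rcases Nat.eq_zero_or_pos (max n₁ n₂) with hn | hn
  · obtain ⟨rfl, rfl⟩ : n₁ = 0 ∧ n₂ = 0 := by omega
    have h0 : ∀ X : Matrix (Fin 0) (Fin 0) ℝ, MatrixRecovery.frobNorm X ^ 2 = 0 := fun X => by
      rw [MatrixRecovery.sq_frobNorm, MatrixRecovery.frobInner_eq_sum]
      simp
    refine ⟨Set.univ, MeasurableSet.univ, ?_, fun ω _ => ⟨fun _ X _ => ?_, fun _ X _ => ?_⟩⟩
    · rw [probReal_univ]
      linarith [Real.exp_pos (-(1 / 2) * (max 0 0 : ℕ))]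
    · simp [h0, MatrixRecovery.oracleRisk]
    · simp [h0, MatrixRecovery.oracleRisk]
  have hs2 : √2 < 2 := by rw [Real.sqrt_lt' (by norm_num)]; norm_num
  have hl : 0 < 8 * √(max n₁ n₂ : ℕ) * σ := by
    have : 0 < √((max n₁ n₂ : ℕ) : ℝ) := Real.sqrt_pos.mpr (by exact_mod_cast hn)
    positivity
  have hrisk := MatrixRecovery.sum_min_le_oracleRisk M σ
  obtain ⟨E, hE, hPE, hnoise⟩ :=
    hz.exists_event_opNorm_adjointMap_le hσ (by omega : 1 ≤ 4 * r) hδ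
  refine ⟨E, hE, ?_, fun ω hω => ⟨fun _ X hX => ?_, fun hδ' X hX => ?_⟩⟩
  · linarith [Real.exp_pos (-(1 / 2) * (max n₁ n₂ : ℕ))]
  · have e : 16 * √(max n₁ n₂ : ℕ) * σ = 2 * (8 * √(max n₁ n₂ : ℕ) * σ) := by ring
    rw [e] at hX
    refine (hX.sq_frobNorm_sub_le hr hM hδ hl (hnoise ω hω)).trans ?_
    refine (mul_le_mul_of_nonneg_left hrisk
      (MatrixRecovery.oracleConst_nonneg (by linarith))).trans_eq ?_
    ring
  · have e : 32 * √(max n₁ n₂ : ℕ) * σ = 4 * (8 * √(max n₁ n₂ : ℕ) * σ) := by ring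
    rw [e] at hX
    refine (hX.sq_frobNorm_sub_le hr hM hδ' hl (hnoise ω hω)).trans ?_
    refine (mul_le_mul_of_nonneg_left hrisk
      (MatrixRecovery.oracleConst_nonneg (by linarith))).trans_eq ?_
    ring
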